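/- Fix $\lambda>0$ and, for $N\ge 1$, put $q=q_N=e^{-\lambda/N}\in(0,1)$. Write $(a;q)_n=\prod_{i=0}^{n-1}(1-aq^i)$, $(a;q)_\infty=\prod_{i\ge 0}(1-aq^i)$ and $(a_1,\dots,a_k;q)_\infty=\prod_{l=1}^k(a_l;q)_\infty$, and let $$\int_0^\alpha f(x)\,d_qx=(1-q)\sum_{k\ge 0}\alpha q^k f(\alpha q^k),\qquad \int_a^b f(x)\,d_qx=\int_0^b f(x)\,d_qx-\int_0^a f(x)\,d_qx$$ be the Jackson integral. Let $$\omega(x)=\frac{(qx,-qx;q)_\infty}{(q,-1,-q;q)_\infty},\qquad H_n(x;q)=\sum_{k=0}^{\lfloor n/2\rfloor}(-1)^k\frac{(q^{-n};q^2)_k(q^{-n+1};q^2)_k\,q^{k(2n-k)}}{(q^2;q^2)_k}x^{n-2k}$$ be the discrete $q$-Hermite weight and polynomials, let $$\rho_N(x)=\frac1{1-q}\sum_{j=0}^{N-1}\frac{H_j(x;q)^2}{(q;q)_j\,q^{j(j-1)/2}}\,\omega(x)$$ be the density (with respect to $d_qx$ on $[-1,1]$) of the discrete $q$-deformed Gaussian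 unitary ensemble, and let $\widehat\rho_N(x)=\sqrt{1-q}\,\rho_N(\sqrt{1-q}\,x)$. Put $$a(\lambda)=\frac{2\sqrt{(1-e^{-\lambda})e^{-\lambda}}}{\sqrt\lambda},\qquad c_N=\frac1{\sqrt{N(1-q)}}\ \Big(\longrightarrow\frac1{\sqrt\lambda}\Big).$$ **Proposition.** As $N\to\infty$ the scaled density $N^{-1/2}\widehat\rho_N(\sqrt N x)$ converges to $\widehat\rho(x)$, a density supported in $|x|\le 1/\sqrt\lambda$, in the sense of integration against test functions: for every continuous $f:\mathbb R\to\mathbb R$ the Jackson series below converges for all $N\ge1$, $f\widehat\rho$ is Lebesgue integrable on $\mathbb R$, and $$\int_{-c_N}^{c_N} f(x)\,\frac1{\sqrt N}\widehat\rho_N(\sqrt N x)\,d_qx\ \longrightarrow\ \int_{\mathbb R} f(x)\,\widehat\rho(x)\,dx .$$ Here, with $\arg\in(-\pi,\pi]$ the principal argument, for $x\ne0$: * if $\lambda\le\log 2$, $$\widehat\rho(x)=\frac1{\pi\lambda x}\arg\left(\frac{2e^{-\lambda}-\sqrt\lambda x+i\sqrt{4(1-e^{-\lambda})e^{-\lambda}-\lambda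 x^2}}{2e^{-\lambda}+\sqrt\lambda x+i\sqrt{4(1-e^{-\lambda})e^{-\lambda}-\lambda x^2}}\right)\mathbf 1_{(-a(\lambda),a(\lambda))}(x);$$ * if $\lambda\ge\log 2$, $$\widehat\rho(x)=\frac1{\pi\lambda x}\arg\left(\frac{2e^{-\lambda}-\sqrt\lambda x+i\sqrt{4(1-e^{-\lambda})e^{-\lambda}-\lambda x^2}}{2e^{-\lambda}+\sqrt\lambda x+i\sqrt{4(1-e^{-\lambda})e^{-\lambda}-\lambda x^2}}\right)\mathbf 1_{(-a(\lambda),a(\lambda))}(x)+\frac1{\lambda|x|}\Big(\mathbf 1_{(-1/\sqrt\lambda,1/\sqrt\lambda)}(x)-\mathbf 1_{(-a(\lambda),a(\lambda))}(x)\Big).$$ -/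

import Mathlib

open Filter Topology MeasureTheory

namespace QGUE

noncomputable section

/-- The finite `q`-Pochhammer symbol `(a; q)_n = (1 - a)(1 - a q) ⋯ (1 - a q^(n-1))`. -/
def qPoch (a q : ℝ) (n : ℕ) : ℝ := ∏ i ∈ Finset.range n, (1 - a * q ^ i)

/-- The infinite `q`-Pochhammer symbol `(a; q)_∞` (used only for `0 < q < 1`, where the product
converges). -/
def qPochInf (a q : ℝ) : ℝ := ∏' i : ℕ, (1 - a * q ^ i)

/-- The Jackson integral `∫_0^α f(x) d_q x = (1 - q) ∑_{k ≥ 0} α q^k f(α q^k)`. -/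
def jacksonZero (q : ℝ) (f : ℝ → ℝ) (α : ℝ) : ℝ :=
  (1 - q) * ∑' k : ℕ, α * q ^ k * f (α * q ^ k)

/-- The Jackson integral `∫_a^b f(x) d_q x`. -/
def jacksonIntegral (q : ℝ) (f : ℝ → ℝ) (a b : ℝ) : ℝ :=
  jacksonZero q f b - jacksonZero q f a

/-- Convergence of the two series defining `∫_a^b f(x) d_q x`. -/
def JacksonIntegrable (q : ℝ) (f : ℝ → ℝ) (a b : ℝ) : Prop :=
  Summable (fun k : ℕ => a * q ^ k * f (a * q ^ k)) ∧
    Summable (fun k : ℕ => b * q ^ k * f (b * q ^ k))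

/-- The discrete `q`-Hermite weight `(qx, -qx; q)_∞ / (q, -1, -q; q)_∞`. -/
def weight (q x : ℝ) : ℝ :=
  (qPochInf (q * x) q * qPochInf (-(q * x)) q) /
    (qPochInf q q * qPochInf (-1) q * qPochInf (-q) q)

/-- The (monic) discrete `q`-Hermite polynomial
`H_n(x; q) = ∑_{k ≤ n/2} (-1)^k (q^(-n); q²)_k (q^(-n+1); q²)_k q^(k(2n-k)) / (q²; q²)_k x^(n-2k)`. -/
def qHermite (q : ℝ) (n : ℕ) (x : ℝ) : ℝ :=
  ∑ k ∈ Finset.range (n / 2 + 1),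
    (-1) ^ k * (qPoch (q ^ (-(n : ℤ))) (q ^ 2) k * qPoch (q ^ (-(n : ℤ) + 1)) (q ^ 2) k *
      q ^ (k * (2 * n - k))) / qPoch (q ^ 2) (q ^ 2) k * x ^ (n - 2 * k)

/-- The density `ρ_N(x)` of the discrete `q`-GUE of size `N`, with respect to the Jackson measure
`d_q x` on `[-1, 1]`. -/
def density (q : ℝ) (N : ℕ) (x : ℝ) : ℝ :=
  1 / (1 - q) * (∑ j ∈ Finset.range N,
    qHermite q j x ^ 2 / (qPoch q q j * q ^ (j * (j - 1) / 2))) * weight q x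

/-- The rescaled density `√(1 - q) ρ_N(√(1 - q) x)`. -/
def densityHat (q : ℝ) (N : ℕ) (x : ℝ) : ℝ :=
  √(1 - q) * density q N (√(1 - q) * x)

/-- The scaling `q = e^(-λ/N)`. -/
def qScale (lam : ℝ) (N : ℕ) : ℝ := Real.exp (-lam / N)

/-- The scaled density `N^(-1/2) ρ̂_N(√N x)` with `q = e^(-λ/N)`. -/
def scaledDensity (lam : ℝ) (N : ℕ) (x : ℝ) : ℝ :=
  1 / √N * densityHat (qScale lam N) N (√N * x)

/-- The endpoint `1 / √(N (1 - q))`, `q = e^(-λ/N)`, of the support of the scaled density. -/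
def endpoint (lam : ℝ) (N : ℕ) : ℝ := 1 / √(N * (1 - qScale lam N))

/-- `a(λ) = 2 √((1 - e^(-λ)) e^(-λ)) / √λ`. -/
def edge (lam : ℝ) : ℝ :=
  2 * √((1 - Real.exp (-lam)) * Real.exp (-lam)) / √lam

/-- The arg-expression, cut off to `(-a(λ), a(λ))`; `Complex.arg` is the principal argument. -/
def argDensity (lam x : ℝ) : ℝ :=
  (Set.Ioo (-edge lam) (edge lam)).indicator (fun x : ℝ =>
    1 / (Real.pi * lam * x) * Complex.arg
      ((((2 * Real.exp (-lam) - √lam * x : ℝ) : ℂ) + Complex.I *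
          ((√(4 * (1 - Real.exp (-lam)) * Real.exp (-lam) - lam * x ^ 2) : ℝ) : ℂ)) /
        (((2 * Real.exp (-lam) + √lam * x : ℝ) : ℂ) + Complex.I *
          ((√(4 * (1 - Real.exp (-lam)) * Real.exp (-lam) - lam * x ^ 2) : ℝ) : ℂ)))) x

/-- The extra piece `(1 / (λ|x|)) (1_{(-1/√λ, 1/√λ)}(x) - 1_{(-a(λ), a(λ))}(x))`. -/
def saturatedDensity (lam x : ℝ) : ℝ :=
  1 / (lam * |x|) *
    ((Set.Ioo (-(1 / √lam)) (1 / √lam)).indicator (fun _ => (1 : ℝ)) x -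
      (Set.Ioo (-edge lam) (edge lam)).indicator (fun _ => (1 : ℝ)) x)

/-- The scaled densities, as measures `N^(-1/2) ρ̂_N(√N x) d_q x` on the `q`-lattice, converge to
the measure `r(x) dx`: convergence of the integrals of every continuous function, all the
integrals being finite. -/
def ScaledDensityTendsto (lam : ℝ) (r : ℝ → ℝ) : Prop :=
  ∀ f : ℝ → ℝ, Continuous f →
    (∀ N : ℕ, 1 ≤ N → JacksonIntegrable (qScale lam N) (fun x => f x * scaledDensity lam N x)
      (-endpoint lam N) (endpoint lam N)) ∧
    Integrable (fun x => f x * r x) ∧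
    Tendsto (fun N : ℕ => jacksonIntegral (qScale lam N) (fun x => f x * scaledDensity lam N x)
      (-endpoint lam N) (endpoint lam N)) atTop (𝓝 (∫ x, f x * r x))

end

end QGUE

/-! Each summand of the density, normalised, is a probability measure on the `q`-lattice with
density p_j² against the weight, where p_j is the `j`-th orthonormal polynomial; the scaled density
is the average of the first N of them. Orthogonality comes from the backward shift relation, which
makes H_(n+1) times the weight a telescoping `q`-difference, and from the three-term recurrence.

In orthonormal form, x p_(j+1) = a_(j+1) p_(j+2) + a_j p_j with a_j² = q^j (1 - q^(j+1)). At j =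
⌊tN⌋ the rescaled coefficients tend to b(t) = √(s(1-s)/λ), s = e^(-λt), and a bounded shift of j
does not change the limit. Hence the means of x^m p_j p_(j+d) satisfy, in the limit, the recursion
in (m, d) of the integrals of (2by)^m T_d(y) against the arcsine law, because 2y T_d = T_(d+1) +
T_(d-1). So p_j² tends weakly to the arcsine law on [-2b, 2b] (`tendsto_latticeMean_walk`,
`tendsto_orthoMean`), and averaging over j becomes integration over t in [0, 1]
(`tendsto_jacksonIntegral`).

The limit has density (1/π) ∫ dt / √(4b(t)² - x²), over the levels t where the root is real. With v
= √λ x and R = √(4s(1-s) - v²), the integrand is the t-derivative of [arg(2s - v + iR) - arg(2s + v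
+ iR)] / (λx). The contributing levels are those with s between (1 ± √(1-v²))/2. Both angles vanish
where this window opens. If t = 1 cuts the window, the value at s = e^(-λ) is the arg formula; if
the window closes earlier, which forces e^(-λ) < 1/2, the angles differ by ±π and the saturated
value 1/(λ|x|) appears. -/

namespace QGUE

noncomputable section

/-! ### The discrete `q`-Hermite polynomials -/

/-- The coefficient of `x ^ (n - 2 * k)` in the discrete `q`-Hermite polynomial `H_n`, free of
negative powers of `q` as long as `2 * k ≤ n`; it vanishes for `2 * k > n`. -/
def hermiteCoeff (q : ℝ) (n k : ℕ) : ℝ :=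
  (-1) ^ k * q ^ (k * (k - 1)) * (∏ i ∈ Finset.range (2 * k), (1 - q ^ ((n : ℤ) - i))) /
    qPoch (q ^ 2) (q ^ 2) k

lemma hermiteCoeff_zero (q : ℝ) (n : ℕ) : hermiteCoeff q n 0 = 1 := by
  simp [hermiteCoeff, qPoch]

lemma hermiteCoeff_eq_zero {q : ℝ} {n k : ℕ} (h : n < 2 * k) : hermiteCoeff q n k = 0 := by
  have : ∏ i ∈ Finset.range (2 * k), (1 - q ^ ((n : ℤ) - i)) = 0 :=
    Finset.prod_eq_zero (Finset.mem_range.2 h) (by simp)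
  simp [hermiteCoeff, this]

lemma qPoch_sq_pos {q : ℝ} (h0 : 0 < q) (h1 : q < 1) (k : ℕ) :
    0 < qPoch (q ^ 2) (q ^ 2) k := by
  refine Finset.prod_pos fun i _ => ?_
  have : q ^ 2 * (q ^ 2) ^ i < 1 := by
    rw [← pow_mul, ← pow_add]
    exact pow_lt_one₀ h0.le h1 (by omega)
  linarith

/-- The two products interleave into one over consecutive exponents. Turning each 1 - q^(-a) into
-q^(-a) (1 - q^a) produces an even number of signs and powers of `q` that combine with q^(k(2n-k)).
The bound `2 * k ≤ n` keeps the truncated subtractions exact. -/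
lemma qPoch_mul_qPoch_mul_pow {q : ℝ} (h0 : 0 < q) {n k : ℕ} (h : 2 * k ≤ n) :
    qPoch (q ^ (-(n : ℤ))) (q ^ 2) k * qPoch (q ^ (-(n : ℤ) + 1)) (q ^ 2) k * q ^ (k * (2 * n - k))
      = q ^ (k * (k - 1)) * ∏ i ∈ Finset.range (2 * k), (1 - q ^ ((n : ℤ) - i)) := by
  have hq : q ≠ 0 := h0.ne'
  induction k with
  | zero => simp [qPoch]
  | succ k ih =>
    have ih := ih (by omega)
    have e1 : (k + 1) * (2 * n - (k + 1)) = k * (2 * n - k) + (2 * n - 2 * k - 1) := by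
      obtain ⟨m, rfl⟩ : ∃ m, n = m + (k + 1) := ⟨n - (k + 1), by omega⟩
      have a1 : 2 * (m + (k + 1)) - (k + 1) = 2 * m + k + 1 := by omega
      have a2 : 2 * (m + (k + 1)) - k = 2 * m + k + 2 := by omega
      have a3 : 2 * (m + (k + 1)) - 2 * k - 1 = 2 * m + 1 := by omega
      rw [a1, a2, a3]; ring
    have e2 : (k + 1) * (k + 1 - 1) = k * (k - 1) + 2 * k := by
      rcases k with _ | k
      · rfl
      · simp only [Nat.add_sub_cancel]; ring
    unfold qPoch at ih ⊢
    rw [Finset.prod_range_succ, Finset.prod_range_succ, e1, e2, pow_add, pow_add,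
      show 2 * (k + 1) = 2 * k + 1 + 1 by ring, Finset.prod_range_succ, Finset.prod_range_succ]
    have key : (1 - q ^ (-(n : ℤ)) * (q ^ 2) ^ k) * (1 - q ^ (-(n : ℤ) + 1) * (q ^ 2) ^ k) *
        q ^ (2 * n - 2 * k - 1) =
        q ^ (2 * k) * ((1 - q ^ ((n : ℤ) - (2 * k : ℕ))) *
          (1 - q ^ ((n : ℤ) - (2 * k + 1 : ℕ)))) := by
      obtain ⟨m, rfl⟩ : ∃ m, n = m + (2 * k + 1) := ⟨n - (2 * k + 1), by omega⟩
      have a1 : 2 * (m + (2 * k + 1)) - 2 * k - 1 = 2 * m + 2 * k + 1 := by omega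
      have a2 : ((m + (2 * k + 1) : ℕ) : ℤ) - (2 * k : ℕ) = (m + 1 : ℕ) := by push_cast; ring
      have a3 : ((m + (2 * k + 1) : ℕ) : ℤ) - (2 * k + 1 : ℕ) = (m : ℕ) := by push_cast; ring
      have a4 : q ^ (-((m + (2 * k + 1) : ℕ) : ℤ)) = (q ^ m * q ^ (2 * k + 1))⁻¹ := by
        rw [zpow_neg, zpow_natCast, pow_add]
      rw [a1, a2, a3, zpow_add₀ hq, a4, zpow_natCast, zpow_natCast, zpow_one]
      field_simp
      ring
    linear_combination (q ^ (2 * k) * ((1 - q ^ ((n : ℤ) - (2 * k : ℕ))) *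
          (1 - q ^ ((n : ℤ) - (2 * k + 1 : ℕ))))) * ih +
      ((∏ i ∈ Finset.range k, (1 - q ^ (-(n : ℤ)) * (q ^ 2) ^ i)) *
        (∏ i ∈ Finset.range k, (1 - q ^ (-(n : ℤ) + 1) * (q ^ 2) ^ i)) * q ^ (k * (2 * n - k))) * key

/-- The free length `K` lets polynomials of neighbouring degrees be summed over matching ranges; the
added coefficients vanish. -/
lemma qHermite_eq_sum {q : ℝ} (h0 : 0 < q) {n K : ℕ} (hK : n / 2 < K) (x : ℝ) :
    qHermite q n x = ∑ k ∈ Finset.range K, hermiteCoeff q n k * x ^ (n - 2 * k) := by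
  rw [← Finset.sum_subset (Finset.range_subset_range.2 (Nat.succ_le_of_lt hK))]
  · refine Finset.sum_congr rfl fun k hk => ?_
    have hk : 2 * k ≤ n := by have := Finset.mem_range.1 hk; omega
    rw [qPoch_mul_qPoch_mul_pow h0 hk, hermiteCoeff]
    ring
  · intro k _ hk
    rw [hermiteCoeff_eq_zero, zero_mul]
    simp only [Finset.mem_range, not_lt] at hk
    omega

lemma hermiteCoeff_succ_succ {q : ℝ} (h0 : 0 < q) (h1 : q < 1) (n k : ℕ) :
    hermiteCoeff q (n + 2) (k + 1) =
      hermiteCoeff q (n + 1) (k + 1) - q ^ n * (1 - q ^ (n + 1)) * hermiteCoeff q n k := by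
  have hq : q ≠ 0 := h0.ne'
  -- Both products are reduced to the one occurring in `hermiteCoeff q n k`; what remains is a
  -- rational identity.
  have p1 : ∏ i ∈ Finset.range (2 * (k + 1)), (1 - q ^ (((n + 2 : ℕ) : ℤ) - i)) =
      (∏ i ∈ Finset.range (2 * k), (1 - q ^ ((n : ℤ) - i))) * (1 - q ^ (n + 1)) *
        (1 - q ^ (n + 2)) := by
    rw [show 2 * (k + 1) = 2 * k + 1 + 1 by ring, Finset.prod_range_succ', Finset.prod_range_succ']
    congr 1
    · congr 1
      · refine Finset.prod_congr rfl fun i _ => ?_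
        congr 2; push_cast; ring
      · rw [← zpow_natCast]; congr 2; push_cast; ring
  have p2 : ∏ i ∈ Finset.range (2 * (k + 1)), (1 - q ^ (((n + 1 : ℕ) : ℤ) - i)) =
      (∏ i ∈ Finset.range (2 * k), (1 - q ^ ((n : ℤ) - i))) * (1 - q ^ ((n : ℤ) - (2 * k : ℕ))) *
        (1 - q ^ (n + 1)) := by
    rw [show 2 * (k + 1) = 2 * k + 1 + 1 by ring, Finset.prod_range_succ', Finset.prod_range_succ]
    congr 1
    · congr 1
      · refine Finset.prod_congr rfl fun i _ => ?_
        congr 2; push_cast; ring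
      · congr 2; push_cast; ring
  have p3 : qPoch (q ^ 2) (q ^ 2) (k + 1) =
      qPoch (q ^ 2) (q ^ 2) k * (1 - q ^ (2 * k + 2)) := by
    rw [qPoch, Finset.prod_range_succ, qPoch]; congr 2; ring
  have e2 : (k + 1) * (k + 1 - 1) = k * (k - 1) + 2 * k := by
    rcases k with _ | k
    · rfl
    · simp only [Nat.add_sub_cancel]; ring
  have n1 := (qPoch_sq_pos h0 h1 k).ne'
  have n2 : 1 - q ^ (2 * k + 2) ≠ 0 := by
    have := pow_lt_one₀ h0.le h1 (show 2 * k + 2 ≠ 0 by omega)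
    linarith
  have z : q ^ ((n : ℤ) - (2 * k : ℕ)) = q ^ n / q ^ (2 * k) := by
    rw [zpow_sub₀ hq, zpow_natCast, zpow_natCast]
  unfold hermiteCoeff
  rw [p1, p2, p3, e2, z]
  field_simp
  ring

/-- The three-term recurrence of the discrete `q`-Hermite polynomials. -/
lemma qHermite_succ_succ {q : ℝ} (h0 : 0 < q) (h1 : q < 1) (n : ℕ) (x : ℝ) :
    qHermite q (n + 2) x =
      x * qHermite q (n + 1) x - q ^ n * (1 - q ^ (n + 1)) * qHermite q n x := by
  rw [qHermite_eq_sum h0 (n := n + 2) (K := n / 2 + 1 + 1) (by omega),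
    qHermite_eq_sum h0 (n := n + 1) (K := n / 2 + 1 + 1) (by omega),
    qHermite_eq_sum h0 (n := n) (K := n / 2 + 1) (by omega),
    Finset.sum_range_succ' _ (n / 2 + 1), Finset.sum_range_succ' _ (n / 2 + 1), mul_add, Finset.mul_sum, Finset.mul_sum,
    hermiteCoeff_zero, hermiteCoeff_zero]
  have : ∀ k ∈ Finset.range (n / 2 + 1),
      hermiteCoeff q (n + 2) (k + 1) * x ^ (n + 2 - 2 * (k + 1)) =
      x * (hermiteCoeff q (n + 1) (k + 1) * x ^ (n + 1 - 2 * (k + 1))) -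
        q ^ n * (1 - q ^ (n + 1)) * (hermiteCoeff q n k * x ^ (n - 2 * k)) := by
    intro k hk
    have hk := Finset.mem_range.1 hk
    rw [hermiteCoeff_succ_succ h0 h1, show n + 2 - 2 * (k + 1) = n - 2 * k by omega]
    -- For n = 2k the truncated exponent `n + 1 - 2 * (k + 1)` is wrong by one, but its coefficient
    -- is zero.
    rcases Nat.lt_or_ge n (2 * k + 1) with h | h
    · rw [hermiteCoeff_eq_zero (n := n + 1) (k := k + 1) (by omega)]; ring
    · rw [show n - 2 * k = n + 1 - 2 * (k + 1) + 1 by omega, pow_succ]; ring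
  rw [Finset.sum_congr rfl this, Finset.sum_sub_distrib]
  simp only [mul_zero, Nat.sub_zero]
  ring

lemma qHermite_zero (q x : ℝ) : qHermite q 0 x = 1 := by simp [qHermite, qPoch]

lemma qHermite_one (q x : ℝ) : qHermite q 1 x = x := by simp [qHermite, qPoch]

lemma continuous_qHermite (q : ℝ) (n : ℕ) : Continuous (qHermite q n) := by
  unfold qHermite; fun_prop

/-- The backward shift relation. -/
lemma mul_qHermite_succ {q : ℝ} (h0 : 0 < q) (h1 : q < 1) (n : ℕ) (x : ℝ) :
    x * qHermite q (n + 1) x = q ^ n * (qHermite q n x - (1 - x ^ 2) * qHermite q n (x / q)) := by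
  have hq : q ≠ 0 := h0.ne'
  induction n using Nat.twoStepInduction with
  | zero => simp [qHermite_zero, qHermite_one]; ring
  | one =>
    rw [qHermite_succ_succ h0 h1 0]
    simp only [zero_add, qHermite_zero, qHermite_one]
    field_simp
    ring
  | more n ih ih' =>
    rw [qHermite_succ_succ h0 h1 (n + 1), qHermite_succ_succ h0 h1 n,
      qHermite_succ_succ h0 h1 n] at *
    set A := qHermite q n x
    set B := qHermite q (n + 1) x
    set A' := qHermite q n (x / q)
    set B' := qHermite q (n + 1) (x / q)
    have : q ^ (n + 1) = q ^ n * q := pow_succ _ _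
    have h2 : q ^ (n + 2) = q ^ n * q ^ 2 := pow_add _ _ _
    rw [show n + 1 + 1 = n + 2 from rfl, h2] at *
    rw [this] at *
    field_simp at *
    linear_combination x * ih' - q ^ n * q * (1 - q ^ n * q) * q * ih

/-! ### Infinite `q`-Pochhammer symbols -/

lemma summable_norm_mul_pow {q : ℝ} (h0 : 0 < q) (h1 : q < 1) (a : ℝ) :
    Summable fun i : ℕ => ‖-(a * q ^ i)‖ := by
  simp only [norm_neg, norm_mul, norm_pow, Real.norm_of_nonneg h0.le]
  exact (summable_geometric_of_lt_one h0.le h1).mul_left _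

lemma tendsto_qPoch {q : ℝ} (h0 : 0 < q) (h1 : q < 1) (a : ℝ) :
    Tendsto (qPoch a q) atTop (𝓝 (qPochInf a q)) := by
  have := (multipliable_one_add_of_summable (summable_norm_mul_pow h0 h1 a)).tendsto_prod_tprod_nat
  simp only [← sub_eq_add_neg] at this
  exact this

lemma qPochInf_nonneg {q a : ℝ} (h0 : 0 < q) (h1 : q < 1) (ha : ∀ i : ℕ, 0 ≤ 1 - a * q ^ i) :
    0 ≤ qPochInf a q :=
  ge_of_tendsto' (tendsto_qPoch h0 h1 a) fun _ => Finset.prod_nonneg fun i _ => ha i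

lemma qPochInf_pos {q a : ℝ} (h0 : 0 < q) (h1 : q < 1) (ha : ∀ i : ℕ, 0 < 1 - a * q ^ i) :
    0 < qPochInf a q := by
  refine lt_of_le_of_ne (qPochInf_nonneg h0 h1 fun i => (ha i).le) (Ne.symm ?_)
  have := tprod_one_add_ne_zero_of_summable (f := fun i : ℕ => -(a * q ^ i))
    (fun i => by rw [← sub_eq_add_neg]; exact (ha i).ne') (summable_norm_mul_pow h0 h1 a)
  simp only [← sub_eq_add_neg] at this
  exact this

lemma one_sub_mul_pow_pos {q a : ℝ} (h0 : 0 < q) (h1 : q < 1) (ha : a < 1) (i : ℕ) :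
    0 < 1 - a * q ^ i := by
  have h2 := pow_pos h0 i
  have h3 := pow_le_one₀ (n := i) h0.le h1.le
  nlinarith

lemma qPoch_pos {q a : ℝ} (h0 : 0 < q) (h1 : q < 1) (ha : a < 1) (n : ℕ) : 0 < qPoch a q n :=
  Finset.prod_pos fun i _ => one_sub_mul_pow_pos h0 h1 ha i

lemma qPochInf_pos' {q a : ℝ} (h0 : 0 < q) (h1 : q < 1) (ha : a < 1) : 0 < qPochInf a q :=
  qPochInf_pos h0 h1 (one_sub_mul_pow_pos h0 h1 ha)

lemma qPoch_succ (a q : ℝ) (n : ℕ) : qPoch a q (n + 1) = qPoch a q n * (1 - a * q ^ n) :=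
  Finset.prod_range_succ _ _

lemma qPoch_succ' (a q : ℝ) (n : ℕ) : qPoch a q (n + 1) = (1 - a) * qPoch (a * q) q n := by
  rw [qPoch, Finset.prod_range_succ', mul_comm, qPoch]
  simp only [pow_zero, mul_one]
  congr 1
  exact Finset.prod_congr rfl fun i _ => by ring

lemma qPochInf_eq_mul {q : ℝ} (h0 : 0 < q) (h1 : q < 1) (a : ℝ) :
    qPochInf a q = (1 - a) * qPochInf (a * q) q := by
  refine tendsto_nhds_unique ((tendsto_qPoch h0 h1 a).comp (tendsto_add_atTop_nat 1)) ?_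
  simpa only [Function.comp_def, qPoch_succ'] using (tendsto_qPoch h0 h1 (a * q)).const_mul (1 - a)

lemma qPochInf_le_qPoch {q a : ℝ} (h0 : 0 < q) (h1 : q < 1) (ha0 : 0 ≤ a) (ha : a < 1) (n : ℕ) :
    qPochInf a q ≤ qPoch a q n := by
  refine Antitone.le_of_tendsto (antitone_nat_of_succ_le fun k => ?_) (tendsto_qPoch h0 h1 a) n
  rw [qPoch_succ]
  have := qPoch_pos h0 h1 ha k
  have h2 : 0 ≤ a * q ^ k := by positivity
  nlinarith

/-- Euler's identity `(-q; q)_∞ (q; q²)_∞ = 1`. -/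
lemma qPochInf_neg_mul_qPochInf {q : ℝ} (h0 : 0 < q) (h1 : q < 1) :
    qPochInf (-q) q * qPochInf q (q ^ 2) = 1 := by
  have s0 : 0 < q ^ 2 := by positivity
  have s1 : q ^ 2 < 1 := pow_lt_one₀ h0.le h1 two_ne_zero
  -- Factoring 1 - q^(2i) gives the first finite identity, sorting exponents by parity the second;
  -- in the limit (q²; q²)_∞ cancels.
  have e1 : ∀ n, qPoch q q n * qPoch (-q) q n = qPoch (q ^ 2) (q ^ 2) n := fun n => by
    rw [qPoch, qPoch, qPoch, ← Finset.prod_mul_distrib]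
    exact Finset.prod_congr rfl fun i _ => by ring
  have e2 : ∀ n, qPoch q q (2 * n) = qPoch q (q ^ 2) n * qPoch (q ^ 2) (q ^ 2) n := fun n => by
    induction n with
    | zero => simp [qPoch]
    | succ n ih =>
      rw [show 2 * (n + 1) = 2 * n + 1 + 1 by ring, qPoch_succ, qPoch_succ, qPoch_succ, qPoch_succ,
        ih]
      ring
  have l1 : qPochInf q q * qPochInf (-q) q = qPochInf (q ^ 2) (q ^ 2) :=
    tendsto_nhds_unique (((tendsto_qPoch h0 h1 q).mul (tendsto_qPoch h0 h1 (-q))).congr e1)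
      (tendsto_qPoch s0 s1 _)
  have l2 : qPochInf q q = qPochInf q (q ^ 2) * qPochInf (q ^ 2) (q ^ 2) :=
    tendsto_nhds_unique (((tendsto_qPoch h0 h1 q).comp
      (tendsto_id.const_mul_atTop' two_pos)).congr e2)
      ((tendsto_qPoch s0 s1 _).mul (tendsto_qPoch s0 s1 _))
  have p1 := qPochInf_pos' h0 h1 h1
  have p2 := qPochInf_pos' s0 s1 s1
  refine mul_right_cancel₀ p2.ne' ?_
  rw [mul_assoc, ← l2, one_mul, ← l1]
  ring

lemma summable_pow_div_qPoch {Q z : ℝ} (h0 : 0 < Q) (h1 : Q < 1) (hz0 : 0 ≤ z) (hz : z < 1) :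
    Summable fun k : ℕ => z ^ k / qPoch Q Q k := by
  refine Summable.of_nonneg_of_le (fun k => div_nonneg (pow_nonneg hz0 k) (qPoch_pos h0 h1 h1 k).le)
    (fun k => ?_) ((summable_geometric_of_lt_one hz0 hz).div_const (qPochInf Q Q))
  exact div_le_div_of_nonneg_left (pow_nonneg hz0 k) (qPochInf_pos' h0 h1 h1)
    (qPochInf_le_qPoch h0 h1 h0.le h1 k)

/-- The `q`-exponential series `∑ z^k / (Q; Q)_k = 1 / (z; Q)_∞`. -/
lemma tsum_pow_div_qPoch_mul {Q z : ℝ} (h0 : 0 < Q) (h1 : Q < 1) (hz0 : 0 ≤ z) (hz : z < 1) :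
    (∑' k : ℕ, z ^ k / qPoch Q Q k) * qPochInf z Q = 1 := by
  set F : ℝ → ℝ := fun z => ∑' k : ℕ, z ^ k / qPoch Q Q k with hF
  -- A functional equation determines the series: iterating it moves the argument to z Q^n → 0,
  -- where the series equals 1.
  have step : ∀ z, 0 ≤ z → z < 1 → F (z * Q) = (1 - z) * F z := by
    intro z hz0 hz
    have s1 := summable_pow_div_qPoch h0 h1 hz0 hz
    have s2 := summable_pow_div_qPoch h0 h1 (mul_nonneg hz0 h0.le)
      (by nlinarith : z * Q < 1)
    have : F z - F (z * Q) = z * F z := by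
      rw [hF]
      simp only
      rw [← s1.tsum_sub s2, (s1.sub s2).tsum_eq_zero_add, ← tsum_mul_left]
      simp only [pow_zero, sub_self, zero_add]
      refine tsum_congr fun k => ?_
      rw [qPoch_succ]
      have p1 := (qPoch_pos h0 h1 h1 k).ne'
      have p2 := (one_sub_mul_pow_pos h0 h1 h1 k).ne'
      field_simp
      ring
    linarith
  have iter : ∀ n, F (z * Q ^ n) = F z * qPoch z Q n := by
    intro n
    induction n with
    | zero => simp [qPoch]
    | succ n ih =>
      have a1 : 0 ≤ z * Q ^ n := by positivity
      have a2 := pow_le_one₀ (n := n) h0.le h1.le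
      have a3 := pow_pos h0 n
      rw [pow_succ, ← mul_assoc, step _ a1 (by nlinarith), ih, qPoch_succ]
      ring
  have lim : Tendsto (fun n : ℕ => F (z * Q ^ n)) atTop (𝓝 1) := by
    have e : (1 : ℝ) = ∑' k : ℕ, (0 : ℝ) ^ k / qPoch Q Q k := by
      rw [tsum_eq_single 0]
      · simp [qPoch]
      · intro k hk; simp [hk]
    rw [e]
    refine tendsto_tsum_of_dominated_convergence (summable_pow_div_qPoch h0 h1 hz0 hz) ?_ ?_
    · intro k
      refine Tendsto.div_const (Tendsto.pow ?_ k) _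
      simpa using (tendsto_pow_atTop_nhds_zero_of_lt_one h0.le h1).const_mul z
    · refine Eventually.of_forall fun n k => ?_
      have a1 : 0 ≤ z * Q ^ n := by positivity
      have a2 := pow_le_one₀ (n := n) h0.le h1.le
      rw [Real.norm_of_nonneg (div_nonneg (pow_nonneg a1 k) (qPoch_pos h0 h1 h1 k).le)]
      refine div_le_div_of_nonneg_right (pow_le_pow_left₀ a1 (by nlinarith) k)
        (qPoch_pos h0 h1 h1 k).le
  exact tendsto_nhds_unique (((tendsto_qPoch h0 h1 z).const_mul (F z)).congr fun n => (iter n).symm)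
    lim

/-! ### The weight on the `q`-lattice -/

lemma weight_neg (q x : ℝ) : weight q (-x) = weight q x := by
  simp only [weight, mul_neg, neg_neg]
  rw [mul_comm (qPochInf (-(q * x)) q)]

/-- Splitting off the first factor of each numerator product. The factor 1 - x² is the one in the
backward shift relation, which is why the sums against the weight telescope. -/
lemma weight_eq_mul {q : ℝ} (h0 : 0 < q) (h1 : q < 1) (x : ℝ) :
    weight q x = (1 - (q * x) ^ 2) * weight q (q * x) := by
  simp only [weight]
  rw [qPochInf_eq_mul h0 h1 (q * x), qPochInf_eq_mul h0 h1 (-(q * x)),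
    show q * x * q = q * (q * x) by ring, show -(q * x) * q = -(q * (q * x)) by ring]
  ring

lemma weight_one {q : ℝ} (h0 : 0 < q) (h1 : q < 1) :
    weight q 1 = 1 / (2 * qPochInf (-q) q) := by
  have p1 := (qPochInf_pos' h0 h1 h1).ne'
  have p2 := (qPochInf_pos' h0 h1 (show -q < 1 by linarith)).ne'
  rw [weight, qPochInf_eq_mul h0 h1 (-1), mul_one, neg_one_mul, sub_neg_eq_add, one_add_one_eq_two]
  field_simp

lemma weight_pow {q : ℝ} (h0 : 0 < q) (h1 : q < 1) (k : ℕ) :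
    weight q (q ^ k) = weight q 1 / qPoch (q ^ 2) (q ^ 2) k := by
  induction k with
  | zero => simp [qPoch]
  | succ k ih =>
    rw [weight_eq_mul h0 h1, ← pow_succ'] at ih
    have s1 : q ^ 2 < 1 := pow_lt_one₀ h0.le h1 two_ne_zero
    have p1 := (qPoch_sq_pos h0 h1 k).ne'
    have p2 := (one_sub_mul_pow_pos (pow_pos h0 2) s1 s1 k).ne'
    have e : (q ^ (k + 1)) ^ 2 = q ^ 2 * (q ^ 2) ^ k := by ring
    rw [e] at ih
    rw [qPoch_succ, ← div_div, ← ih]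
    field_simp

/-- The mass, with respect to `weight q x d_q x / (1 - q)`, of each of the two points `± q ^ k`. -/
def latticeMass (q : ℝ) (k : ℕ) : ℝ := q ^ k * weight q (q ^ k)

lemma weight_one_pos {q : ℝ} (h0 : 0 < q) (h1 : q < 1) : 0 < weight q 1 := by
  have := qPochInf_pos' h0 h1 (show -q < 1 by linarith)
  rw [weight_one h0 h1]; positivity

lemma latticeMass_nonneg {q : ℝ} (h0 : 0 < q) (h1 : q < 1) (k : ℕ) : 0 ≤ latticeMass q k := by
  rw [latticeMass, weight_pow h0 h1]
  have := weight_one_pos h0 h1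
  have := qPoch_sq_pos h0 h1 k
  positivity

lemma summable_latticeMass {q : ℝ} (h0 : 0 < q) (h1 : q < 1) : Summable (latticeMass q) := by
  have s1 : q ^ 2 < 1 := pow_lt_one₀ h0.le h1 two_ne_zero
  refine ((summable_pow_div_qPoch (pow_pos h0 2) s1 h0.le h1).mul_left (weight q 1)).congr
    fun k => ?_
  rw [latticeMass, weight_pow h0 h1]; ring

/-- The masses form the `q`-exponential series in base q² at z = q, and Euler's identity evaluates
its sum as (-q; q)_∞. The points ±q^k together then have mass one. -/
lemma tsum_latticeMass {q : ℝ} (h0 : 0 < q) (h1 : q < 1) : ∑' k, latticeMass q k = 1 / 2 := by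
  have s1 : q ^ 2 < 1 := pow_lt_one₀ h0.le h1 two_ne_zero
  have e : ∑' k, latticeMass q k = weight q 1 * ∑' k : ℕ, q ^ k / qPoch (q ^ 2) (q ^ 2) k := by
    rw [← tsum_mul_left]
    refine tsum_congr fun k => ?_
    rw [latticeMass, weight_pow h0 h1]; ring
  have a := tsum_pow_div_qPoch_mul (pow_pos h0 2) s1 h0.le h1
  have b := qPochInf_neg_mul_qPochInf h0 h1
  have p2 := (qPochInf_pos' h0 h1 (show -q < 1 by linarith)).ne'
  have p3 := (qPochInf_pos' (pow_pos h0 2) s1 h1).ne'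
  rw [e, weight_one h0 h1]
  have : (∑' k : ℕ, q ^ k / qPoch (q ^ 2) (q ^ 2) k) = qPochInf (-q) q :=
    mul_right_cancel₀ p3 (a.trans b.symm)
  rw [this]
  field_simp

/-- The expectation `(1 - q)⁻¹ ∫_{-1}^1 g(x) ω(x) d_q x`. -/
def latticeMean (q : ℝ) (g : ℝ → ℝ) : ℝ :=
  ∑' k, latticeMass q k * (g (q ^ k) + g (-q ^ k))

lemma abs_pow_le_one {q : ℝ} (h0 : 0 < q) (h1 : q < 1) (k : ℕ) : |q ^ k| ≤ 1 := by
  rw [abs_of_pos (pow_pos h0 k)]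
  exact pow_le_one₀ h0.le h1.le

lemma exists_abs_le_of_continuous {g : ℝ → ℝ} (hg : Continuous g) (R : ℝ) :
    ∃ C, ∀ x, |x| ≤ R → |g x| ≤ C := by
  obtain ⟨C, hC⟩ := (isCompact_Icc (a := -R) (b := R)).exists_bound_of_continuousOn hg.continuousOn
  exact ⟨C, fun x hx => hC x (abs_le.1 hx)⟩

lemma summable_latticeMass_mul {q : ℝ} (h0 : 0 < q) (h1 : q < 1) {g : ℝ → ℝ} (hg : Continuous g) :
    Summable fun k => latticeMass q k * g (q ^ k) := by
  obtain ⟨C, hC⟩ := exists_abs_le_of_continuous hg 1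
  refine Summable.of_norm_bounded ((summable_latticeMass h0 h1).mul_right C) fun k => ?_
  rw [norm_mul, Real.norm_of_nonneg (latticeMass_nonneg h0 h1 k)]
  exact mul_le_mul_of_nonneg_left (hC _ (abs_pow_le_one h0 h1 k)) (latticeMass_nonneg h0 h1 k)

lemma summable_latticeMass_mul_neg {q : ℝ} (h0 : 0 < q) (h1 : q < 1) {g : ℝ → ℝ}
    (hg : Continuous g) : Summable fun k => latticeMass q k * g (-q ^ k) :=
  summable_latticeMass_mul h0 h1 (g := fun x => g (-x)) (by fun_prop)

lemma summable_latticeMean {q : ℝ} (h0 : 0 < q) (h1 : q < 1) {g : ℝ → ℝ} (hg : Continuous g) :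
    Summable fun k => latticeMass q k * (g (q ^ k) + g (-q ^ k)) := by
  simpa only [mul_add] using
    (summable_latticeMass_mul h0 h1 hg).add (summable_latticeMass_mul_neg h0 h1 hg)

lemma latticeMean_add {q : ℝ} (h0 : 0 < q) (h1 : q < 1) {f g : ℝ → ℝ} (hf : Continuous f)
    (hg : Continuous g) :
    latticeMean q (fun x => f x + g x) = latticeMean q f + latticeMean q g := by
  rw [latticeMean, latticeMean, latticeMean,
    ← (summable_latticeMean h0 h1 hf).tsum_add (summable_latticeMean h0 h1 hg)]
  exact tsum_congr fun k => by ring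

lemma latticeMean_const_mul (q c : ℝ) (g : ℝ → ℝ) :
    latticeMean q (fun x => c * g x) = c * latticeMean q g := by
  rw [latticeMean, latticeMean, ← tsum_mul_left]
  exact tsum_congr fun k => by ring

lemma latticeMean_sub {q : ℝ} (h0 : 0 < q) (h1 : q < 1) {f g : ℝ → ℝ} (hf : Continuous f)
    (hg : Continuous g) :
    latticeMean q (fun x => f x - g x) = latticeMean q f - latticeMean q g := by
  have := latticeMean_add h0 h1 hf (hg.const_mul (-1) : Continuous fun x => -1 * g x)
  rw [latticeMean_const_mul] at this
  simp only [neg_one_mul, ← sub_eq_add_neg] at this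
  exact this

lemma latticeMean_one {q : ℝ} (h0 : 0 < q) (h1 : q < 1) : latticeMean q (fun _ => 1) = 1 := by
  rw [latticeMean, tsum_mul_right, tsum_latticeMass h0 h1]; norm_num

lemma latticeMean_mono {q : ℝ} (h0 : 0 < q) (h1 : q < 1) {f g : ℝ → ℝ} (hf : Continuous f)
    (hg : Continuous g) (h : ∀ x, |x| ≤ 1 → f x ≤ g x) : latticeMean q f ≤ latticeMean q g := by
  refine (summable_latticeMean h0 h1 hf).tsum_le_tsum (fun k => ?_) (summable_latticeMean h0 h1 hg)
  have h2 := abs_pow_le_one h0 h1 k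
  exact mul_le_mul_of_nonneg_left (add_le_add (h _ h2) (h _ (by rwa [abs_neg])))
    (latticeMass_nonneg h0 h1 k)

lemma latticeMean_sum {q : ℝ} (h0 : 0 < q) (h1 : q < 1) {ι : Type*} (s : Finset ι)
    {f : ι → ℝ → ℝ} (hf : ∀ i, Continuous (f i)) :
    latticeMean q (fun x => ∑ i ∈ s, f i x) = ∑ i ∈ s, latticeMean q (f i) := by
  simp only [latticeMean]
  rw [← Summable.tsum_finsetSum fun i _ => summable_latticeMean h0 h1 (hf i)]
  exact tsum_congr fun k => by rw [← Finset.sum_add_distrib, Finset.mul_sum]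

/-! ### Orthogonality -/

/-- Summation by parts: partial sums collapse to a boundary term proportional to H_n(q^K) -
H_n(-q^K), which tends to 0 by continuity of H_n at 0. -/
lemma latticeMean_qHermite_succ {q : ℝ} (h0 : 0 < q) (h1 : q < 1) (n : ℕ) :
    latticeMean q (qHermite q (n + 1)) = 0 := by
  have hc := continuous_qHermite q n
  have s1 : q ^ 2 < 1 := pow_lt_one₀ h0.le h1 two_ne_zero
  have part : ∀ K, ∑ k ∈ Finset.range (K + 1), latticeMass q k *
      (qHermite q (n + 1) (q ^ k) + qHermite q (n + 1) (-q ^ k)) =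
      q ^ n * (weight q (q ^ K) * (qHermite q n (q ^ K) - qHermite q n (-q ^ K))) := by
    intro K
    induction K with
    | zero =>
      have e1 := mul_qHermite_succ h0 h1 n 1
      have e2 := mul_qHermite_succ h0 h1 n (-1)
      simp only [zero_add, Finset.sum_range_one, latticeMass, pow_zero]
      linear_combination weight q 1 * e1 - weight q 1 * e2
    | succ K ih =>
      rw [Finset.sum_range_succ, ih, latticeMass, weight_eq_mul h0 h1 (q ^ K), ← pow_succ']
      have e1 := mul_qHermite_succ h0 h1 n (q ^ (K + 1))
      have e2 := mul_qHermite_succ h0 h1 n (-q ^ (K + 1))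
      have d1 : q ^ (K + 1) / q = q ^ K := by rw [pow_succ]; field_simp
      rw [d1] at e1
      rw [neg_div, d1] at e2
      linear_combination weight q (q ^ (K + 1)) * e1 - weight q (q ^ (K + 1)) * e2
  have lim := ((summable_latticeMean h0 h1
    (continuous_qHermite q (n + 1))).hasSum.tendsto_sum_nat).comp (tendsto_add_atTop_nat 1)
  refine tendsto_nhds_unique lim ?_
  simp only [Function.comp_def, part]
  have hq := tendsto_pow_atTop_nhds_zero_of_lt_one h0.le h1
  have l1 : Tendsto (fun K : ℕ => weight q (q ^ K)) atTop
      (𝓝 (weight q 1 / qPochInf (q ^ 2) (q ^ 2))) := by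
    simp only [weight_pow h0 h1]
    exact tendsto_const_nhds.div (tendsto_qPoch (pow_pos h0 2) s1 _)
      (qPochInf_pos' (pow_pos h0 2) s1 s1).ne'
  have l2 : Tendsto (fun K : ℕ => qHermite q n (q ^ K) - qHermite q n (-q ^ K)) atTop (𝓝 0) := by
    have a := (hc.tendsto 0).comp hq
    have b := (hc.tendsto 0).comp (by simpa using hq.neg : Tendsto (fun k : ℕ => -q ^ k) atTop (𝓝 0))
    simpa using a.sub b
  simpa using (l1.mul l2).const_mul (q ^ n)

/-- The squared norm of `H_n` with respect to the normalised weight. -/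
def sqNorm (q : ℝ) (n : ℕ) : ℝ := qPoch q q n * q ^ (n * (n - 1) / 2)

lemma sqNorm_zero (q : ℝ) : sqNorm q 0 = 1 := by simp [sqNorm, qPoch]

lemma sqNorm_succ (q : ℝ) (n : ℕ) :
    sqNorm q (n + 1) = q ^ n * (1 - q ^ (n + 1)) * sqNorm q n := by
  have : (n + 1) * (n + 1 - 1) / 2 = n * (n - 1) / 2 + n := by
    rw [← Finset.sum_range_id, ← Finset.sum_range_id, Finset.sum_range_succ]
  rw [sqNorm, sqNorm, this, qPoch_succ]
  ring

lemma sqNorm_pos {q : ℝ} (h0 : 0 < q) (h1 : q < 1) (n : ℕ) : 0 < sqNorm q n :=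
  mul_pos (qPoch_pos h0 h1 h1 n) (pow_pos h0 _)

/-- The recurrence is used twice to move a factor x from one polynomial to the other, lowering `m`
until only the vanishing mean of a single H_n is needed. -/
lemma latticeMean_qHermite_mul {q : ℝ} (h0 : 0 < q) (h1 : q < 1) (m n : ℕ) :
    latticeMean q (fun x => qHermite q m x * qHermite q n x) =
      if m = n then sqNorm q n else 0 := by
  have hc := continuous_qHermite q
  have base : ∀ n, latticeMean q (fun x => qHermite q 0 x * qHermite q n x) =
      if 0 = n then sqNorm q n else 0 := by
    intro n
    simp only [qHermite_zero, one_mul]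
    rcases n with _ | n
    · simp only [qHermite_zero, latticeMean_one h0 h1, sqNorm_zero, if_true]
    · simpa using latticeMean_qHermite_succ h0 h1 n
  have base' : ∀ m, latticeMean q (fun x => qHermite q m x * qHermite q 0 x) =
      if m = 0 then sqNorm q 0 else 0 := by
    intro m
    simp only [mul_comm (qHermite q m _)]
    rw [base]
    rcases m with _ | m <;> simp
  induction m using Nat.twoStepInduction generalizing n with
  | zero => exact base n
  | one =>
    rcases n with _ | n
    · exact base' 1
    · have e : (fun x => qHermite q 1 x * qHermite q (n + 1) x) = fun x =>
          qHermite q 0 x * qHermite q (n + 2) x +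
            q ^ n * (1 - q ^ (n + 1)) * (qHermite q 0 x * qHermite q n x) := by
        ext x
        rw [qHermite_succ_succ h0 h1, qHermite_one, qHermite_zero]; ring
      rw [e, latticeMean_add h0 h1 (by fun_prop) (by fun_prop), latticeMean_const_mul, base, base]
      rcases n with _ | n
      · simp [sqNorm_succ]
      · simp
  | more m ih ih' =>
    rcases n with _ | n
    · exact base' _
    · have e : (fun x => qHermite q (m + 2) x * qHermite q (n + 1) x) = fun x =>
          (qHermite q (m + 1) x * qHermite q (n + 2) x +
            q ^ n * (1 - q ^ (n + 1)) * (qHermite q (m + 1) x * qHermite q n x)) -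
            q ^ m * (1 - q ^ (m + 1)) * (qHermite q m x * qHermite q (n + 1) x) := by
        ext x
        rw [qHermite_succ_succ h0 h1, qHermite_succ_succ h0 h1]; ring
      rw [e, latticeMean_sub h0 h1 (by fun_prop) (by fun_prop),
        latticeMean_add h0 h1 (by fun_prop) (by fun_prop), latticeMean_const_mul,
        latticeMean_const_mul, ih, ih', ih']
      by_cases a : m + 1 = n + 2
      · obtain rfl : m = n + 1 := by omega
        have : n + 1 + 1 ≠ n := by omega
        simp [sqNorm_succ, this]
      · by_cases b : m + 1 = n
        · subst b
          have : m ≠ m + 1 + 1 := by omega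
          simp [sqNorm_succ, this]
        · have c1 : m ≠ n + 1 := by omega
          have c2 : m + 2 ≠ n + 1 := by omega
          simp [b, c1, c2]

/-! ### Orthonormal functions and their three-term recurrence -/

/-- The orthonormal discrete `q`-Hermite polynomials. -/
def orthonormal (q : ℝ) (n : ℕ) (x : ℝ) : ℝ := qHermite q n x / √(sqNorm q n)

/-- The off-diagonal Jacobi coefficient linking the indices `n` and `n + 1`. -/
def jacobiCoeff (q : ℝ) (n : ℕ) : ℝ := √(q ^ n * (1 - q ^ (n + 1)))

lemma continuous_orthonormal (q : ℝ) (n : ℕ) : Continuous (orthonormal q n) :=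
  (continuous_qHermite q n).div_const _

lemma latticeMean_orthonormal_mul {q : ℝ} (h0 : 0 < q) (h1 : q < 1) (m n : ℕ) :
    latticeMean q (fun x => orthonormal q m x * orthonormal q n x) = if m = n then 1 else 0 := by
  have e : (fun x => orthonormal q m x * orthonormal q n x) = fun x =>
      (√(sqNorm q m) * √(sqNorm q n))⁻¹ * (qHermite q m x * qHermite q n x) := by
    ext x; rw [orthonormal, orthonormal, div_mul_div_comm]; ring
  rw [e, latticeMean_const_mul, latticeMean_qHermite_mul h0 h1]
  split_ifs with h
  · subst h
    have := sqNorm_pos h0 h1 m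
    rw [Real.mul_self_sqrt this.le, inv_mul_cancel₀ this.ne']
  · simp

/-- The recurrence becomes symmetric because the ratio of consecutive squared norms is exactly its
coefficient. -/
lemma mul_orthonormal_succ {q : ℝ} (h0 : 0 < q) (h1 : q < 1) (n : ℕ) (x : ℝ) :
    x * orthonormal q (n + 1) x = jacobiCoeff q (n + 1) * orthonormal q (n + 2) x +
      jacobiCoeff q n * orthonormal q n x := by
  have key : ∀ n, √(sqNorm q (n + 1)) = jacobiCoeff q n * √(sqNorm q n) ∧ 0 < jacobiCoeff q n := by
    intro n
    have a : 0 < q ^ n * (1 - q ^ (n + 1)) :=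
      mul_pos (pow_pos h0 n) (by have := pow_lt_one₀ h0.le h1 (Nat.add_one_ne_zero n); linarith)
    exact ⟨by rw [sqNorm_succ, Real.sqrt_mul a.le]; rfl, Real.sqrt_pos.2 a⟩
  have h2 : jacobiCoeff q n ^ 2 = q ^ n * (1 - q ^ (n + 1)) := by
    refine Real.sq_sqrt (mul_pos (pow_pos h0 n) ?_).le
    have := pow_lt_one₀ h0.le h1 (Nat.add_one_ne_zero n); linarith
  have p := Real.sqrt_pos.2 (sqNorm_pos h0 h1 n)
  obtain ⟨e1, p1⟩ := key n
  obtain ⟨e2, p2⟩ := key (n + 1)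
  simp only [orthonormal]
  rw [qHermite_succ_succ h0 h1, e2, e1, ← h2]
  field_simp
  ring

/-- The mean of `f` under the probability measure with density the square of the `n`-th orthonormal
polynomial. -/
def orthoMean (q : ℝ) (n : ℕ) (f : ℝ → ℝ) : ℝ :=
  latticeMean q (fun x => f x * (orthonormal q n x * orthonormal q n x))

lemma orthoMean_sub {q : ℝ} (h0 : 0 < q) (h1 : q < 1) (n : ℕ) {f g : ℝ → ℝ} (hf : Continuous f)
    (hg : Continuous g) :
    orthoMean q n (fun x => f x - g x) = orthoMean q n f - orthoMean q n g := by
  have := continuous_orthonormal q n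
  rw [orthoMean, orthoMean, orthoMean, ← latticeMean_sub h0 h1 (by fun_prop) (by fun_prop)]
  simp only [sub_mul]

/-- `orthoMean` is a positive functional of total mass one, living on [-1, 1]. -/
lemma abs_orthoMean_le {q : ℝ} (h0 : 0 < q) (h1 : q < 1) (n : ℕ) {f : ℝ → ℝ} (hf : Continuous f)
    {C : ℝ} (hC : ∀ x, |x| ≤ 1 → |f x| ≤ C) : |orthoMean q n f| ≤ C := by
  have hc := continuous_orthonormal q n
  have e : ∀ c : ℝ, latticeMean q (fun x => c * (orthonormal q n x * orthonormal q n x)) = c := by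
    intro c
    rw [latticeMean_const_mul, latticeMean_orthonormal_mul h0 h1]; simp
  rw [abs_le]
  constructor
  · rw [← e (-C)]
    refine latticeMean_mono h0 h1 (by fun_prop) (by fun_prop) fun x hx => ?_
    exact mul_le_mul_of_nonneg_right (abs_le.1 (hC x hx)).1 (mul_self_nonneg _)
  · rw [← e C]
    refine latticeMean_mono h0 h1 (by fun_prop) (by fun_prop) fun x hx => ?_
    exact mul_le_mul_of_nonneg_right (abs_le.1 (hC x hx)).2 (mul_self_nonneg _)

/-! ### The scaling -/

lemma qScale_pos (lam : ℝ) (N : ℕ) : 0 < qScale lam N := Real.exp_pos _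

lemma qScale_lt_one {lam : ℝ} (hlam : 0 < lam) {N : ℕ} (hN : 1 ≤ N) : qScale lam N < 1 := by
  have : (0 : ℝ) < N := by exact_mod_cast hN
  rw [qScale, Real.exp_lt_one_iff, neg_div]
  have := div_pos hlam this
  linarith

lemma qScale_pow (lam : ℝ) (N n : ℕ) : qScale lam N ^ n = Real.exp (-(lam * (n / N))) := by
  rw [qScale, ← Real.exp_nat_mul]; congr 1; ring

lemma natCast_mul_one_sub_qScale_le {lam : ℝ} {N : ℕ} (hN : 1 ≤ N) :
    N * (1 - qScale lam N) ≤ lam := by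
  have hN : (0 : ℝ) < N := by exact_mod_cast hN
  have h := Real.add_one_le_exp (-lam / N)
  have : (N : ℝ) * (1 - qScale lam N) ≤ N * (lam / N) :=
    mul_le_mul_of_nonneg_left (by rw [qScale]; rw [neg_div] at h ⊢; linarith) hN.le
  rwa [mul_div_cancel₀ _ hN.ne'] at this

lemma le_natCast_mul_one_sub_qScale {lam : ℝ} (hlam : 0 < lam) {N : ℕ} (hN : 1 ≤ N) :
    lam / (1 + lam / N) ≤ N * (1 - qScale lam N) := by
  have hN : (0 : ℝ) < N := by exact_mod_cast hN
  have h := Real.add_one_le_exp (lam / N)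
  have p : 0 < lam / N := by positivity
  have e : qScale lam N ≤ 1 / (1 + lam / N) := by
    rw [qScale, neg_div, Real.exp_neg, ← one_div]
    exact one_div_le_one_div_of_le (by linarith) (by linarith)
  have : (N : ℝ) * (1 - 1 / (1 + lam / N)) ≤ N * (1 - qScale lam N) :=
    mul_le_mul_of_nonneg_left (by linarith) hN.le
  convert this using 1
  field_simp
  ring

lemma tendsto_natCast_mul_one_sub_qScale {lam : ℝ} (hlam : 0 < lam) :
    Tendsto (fun N : ℕ => N * (1 - qScale lam N)) atTop (𝓝 lam) := by
  refine tendsto_of_tendsto_of_tendsto_of_le_of_le' (g := fun N : ℕ => lam / (1 + lam / N))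
    (h := fun _ => lam) ?_ tendsto_const_nhds ?_ ?_
  · have : Tendsto (fun N : ℕ => lam / (1 + lam / N)) atTop (𝓝 (lam / (1 + 0))) :=
      tendsto_const_nhds.div (tendsto_const_nhds.add (tendsto_const_div_atTop_nhds_zero_nat lam))
        (by norm_num)
    simpa using this
  · filter_upwards [eventually_ge_atTop 1] with N hN using le_natCast_mul_one_sub_qScale hlam hN
  · filter_upwards [eventually_ge_atTop 1] with N hN using natCast_mul_one_sub_qScale_le hN

lemma tendsto_endpoint {lam : ℝ} (hlam : 0 < lam) :
    Tendsto (endpoint lam) atTop (𝓝 (1 / √lam)) := by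
  unfold endpoint
  exact tendsto_const_nhds.div (tendsto_natCast_mul_one_sub_qScale hlam).sqrt
    (Real.sqrt_pos.2 hlam).ne'

lemma natCast_mul_one_sub_qScale_pos {lam : ℝ} (hlam : 0 < lam) {N : ℕ} (hN : 1 ≤ N) :
    0 < N * (1 - qScale lam N) := by
  have h := qScale_lt_one hlam hN
  have hN : (0 : ℝ) < N := by exact_mod_cast hN
  exact mul_pos hN (by linarith)

lemma endpoint_pos {lam : ℝ} (hlam : 0 < lam) {N : ℕ} (hN : 1 ≤ N) : 0 < endpoint lam N :=
  one_div_pos.2 (Real.sqrt_pos.2 (natCast_mul_one_sub_qScale_pos hlam hN))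

/-- A uniform bound for the supports of all scaled densities. -/
def radius (lam : ℝ) : ℝ := 1 / √(lam / (1 + lam))

/-- The lower bound λ/(1 + λ/N) for N(1 - q) increases with N, so its value at N = 1 serves for all
N. -/
lemma endpoint_le_radius {lam : ℝ} (hlam : 0 < lam) {N : ℕ} (hN : 1 ≤ N) :
    endpoint lam N ≤ radius lam := by
  refine one_div_le_one_div_of_le (Real.sqrt_pos.2 (by positivity)) (Real.sqrt_le_sqrt ?_)
  refine le_trans ?_ (le_natCast_mul_one_sub_qScale hlam hN)
  have h1 : (1 : ℝ) ≤ N := by exact_mod_cast hN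
  refine div_le_div_of_nonneg_left hlam.le (by positivity) ?_
  have := div_le_self hlam.le h1
  linarith

lemma one_div_sqrt_le_radius {lam : ℝ} (hlam : 0 < lam) : 1 / √lam ≤ radius lam := by
  refine one_div_le_one_div_of_le (Real.sqrt_pos.2 (by positivity)) (Real.sqrt_le_sqrt ?_)
  exact div_le_self hlam.le (by linarith)

/-- Half the half-width of the support of the local arcsine law at the level `t`. -/
def arcsineScale (lam t : ℝ) : ℝ :=
  √(Real.exp (-(lam * t)) * (1 - Real.exp (-(lam * t)))) / √lam

lemma arcsineScale_nonneg (lam t : ℝ) : 0 ≤ arcsineScale lam t := by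
  unfold arcsineScale; positivity

lemma two_mul_arcsineScale_le (lam t : ℝ) : 2 * arcsineScale lam t ≤ 1 / √lam := by
  rw [arcsineScale, ← mul_div_assoc]
  refine div_le_div_of_nonneg_right ?_ (Real.sqrt_nonneg _)
  set s := Real.exp (-(lam * t))
  have : √(s * (1 - s)) ≤ 1 / 2 :=
    Real.sqrt_le_iff.2 ⟨by norm_num, by nlinarith [sq_nonneg (s - 1 / 2)]⟩
  linarith

/-- The index at distance `d` from the level `⌊t N⌋`. -/
def levelIndex (t : ℝ) (d : ℤ) (N : ℕ) : ℕ := ((⌊t * N⌋₊ : ℤ) + d).toNat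

/-- Since ⌊tN⌋ tends to infinity, the truncation by `toNat` eventually plays no role, even for
negative `d`. -/
lemma eventually_levelIndex_eq {t : ℝ} (ht : 0 < t) (d : ℤ) :
    ∀ᶠ N : ℕ in atTop, (levelIndex t d N : ℤ) = ⌊t * N⌋₊ + d := by
  have : Tendsto (fun N : ℕ => ⌊t * N⌋₊) atTop atTop :=
    tendsto_nat_floor_atTop.comp (tendsto_natCast_atTop_atTop.const_mul_atTop ht)
  filter_upwards [this.eventually_ge_atTop d.natAbs] with N hN
  unfold levelIndex
  omega

lemma tendsto_levelIndex_div {t : ℝ} (ht : 0 < t) (d : ℤ) :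
    Tendsto (fun N : ℕ => (levelIndex t d N : ℝ) / N) atTop (𝓝 t) := by
  have h1 : Tendsto (fun N : ℕ => (⌊t * N⌋₊ : ℝ) / N) atTop (𝓝 t) :=
    (tendsto_nat_floor_mul_div_atTop ht.le).comp tendsto_natCast_atTop_atTop
  have h2 := h1.add (tendsto_const_div_atTop_nhds_zero_nat (d : ℝ))
  rw [add_zero] at h2
  refine h2.congr' ?_
  filter_upwards [eventually_levelIndex_eq ht d] with N hN
  rw [← add_div]
  congr 1
  exact_mod_cast hN.symm

/-- The coefficients vary on the scale N, so a fixed shift `d` is invisible in the limit: near level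
t the Jacobi matrix looks constant. -/
lemma tendsto_endpoint_mul_jacobiCoeff {lam : ℝ} (hlam : 0 < lam) {t : ℝ} (ht : 0 < t) (d : ℤ) :
    Tendsto (fun N : ℕ => endpoint lam N * jacobiCoeff (qScale lam N) (levelIndex t d N)) atTop
      (𝓝 (arcsineScale lam t)) := by
  have h1 : Tendsto (fun N : ℕ => qScale lam N ^ levelIndex t d N) atTop
      (𝓝 (Real.exp (-(lam * t)))) := by
    simp only [qScale_pow]
    exact (Real.continuous_exp.tendsto _).comp ((tendsto_levelIndex_div ht d).const_mul lam).neg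
  have h2 : Tendsto (qScale lam) atTop (𝓝 1) := by
    have := (Real.continuous_exp.tendsto _).comp (tendsto_const_div_atTop_nhds_zero_nat (-lam))
    rw [Real.exp_zero] at this
    exact this
  have h3 := (tendsto_endpoint hlam).mul
    (h1.mul ((h1.mul h2).const_sub 1)).sqrt
  rw [mul_one, one_div_mul_eq_div] at h3
  simp only [jacobiCoeff, pow_succ]
  exact h3

/-! ### Convergence at a fixed level -/

open Polynomial.Chebyshev in
/-- Moments of the arcsine law of scale `b` against a Chebyshev polynomial. -/
def arcsineMoment (b : ℝ) (m : ℕ) (d : ℤ) : ℝ :=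
  1 / Real.pi * ∫ y, (2 * b * y) ^ m * (Polynomial.Chebyshev.T ℝ d).eval y ∂measureT

open Polynomial.Chebyshev in
lemma arcsineMoment_zero (b : ℝ) (d : ℤ) : arcsineMoment b 0 d = if d = 0 then 1 else 0 := by
  simp only [arcsineMoment, pow_zero, one_mul]
  split_ifs with h
  · rw [h, integral_eval_T_real_measureT_zero, one_div_mul_cancel Real.pi_pos.ne']
  · rw [integral_eval_T_real_measureT_of_ne_zero h, mul_zero]

open Polynomial.Chebyshev in
-- The Chebyshev recurrence 2y T_d = T_(d+1) + T_(d-1) is that of a Jacobi matrix with constant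
-- coefficient `b`.
lemma arcsineMoment_succ (b : ℝ) (m : ℕ) (d : ℤ) :
    arcsineMoment b (m + 1) d = b * arcsineMoment b m (d + 1) + b * arcsineMoment b m (d - 1) := by
  have e : ∀ y : ℝ, (2 * b * y) ^ (m + 1) * (T ℝ d).eval y =
      b * ((2 * b * y) ^ m * (T ℝ (d + 1)).eval y) +
        b * ((2 * b * y) ^ m * (T ℝ (d - 1)).eval y) := by
    intro y
    rw [T_add_one]
    simp only [Polynomial.eval_sub, Polynomial.eval_mul, Polynomial.eval_ofNat, Polynomial.eval_X]
    ring
  simp only [arcsineMoment, e]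
  rw [integral_add (integrable_measureT (by fun_prop)) (integrable_measureT (by fun_prop)),
    integral_const_mul, integral_const_mul]
  ring

/-- Each factor x shifts `d` by ±1 with a coefficient tending to b(t), as in `arcsineMoment_succ`;
for m = 0 both sides reduce to orthogonality. All `d` are needed to close the induction, though only
d = 0 is used later. -/
lemma tendsto_latticeMean_walk {lam : ℝ} (hlam : 0 < lam) {t : ℝ} (ht : 0 < t) (m : ℕ) (d : ℤ) :
    Tendsto (fun N : ℕ => latticeMean (qScale lam N) (fun x => (endpoint lam N * x) ^ m *
        (orthonormal (qScale lam N) (levelIndex t 0 N) x *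
          orthonormal (qScale lam N) (levelIndex t d N) x))) atTop
      (𝓝 (arcsineMoment (arcsineScale lam t) m d)) := by
  induction m generalizing d with
  | zero =>
    rw [arcsineMoment_zero]
    refine tendsto_const_nhds.congr' ?_
    filter_upwards [eventually_levelIndex_eq ht d, eventually_levelIndex_eq ht 0,
      eventually_ge_atTop 1] with N h1 h2 hN
    simp only [pow_zero, one_mul]
    rw [latticeMean_orthonormal_mul (qScale_pos _ _) (qScale_lt_one hlam hN)]
    congr 1
    rw [eq_iff_iff]
    omega
  | succ m ih =>
    rw [arcsineMoment_succ]
    refine (((tendsto_endpoint_mul_jacobiCoeff hlam ht d).mul (ih (d + 1))).add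
      ((tendsto_endpoint_mul_jacobiCoeff hlam ht (d - 1)).mul (ih (d - 1)))).congr' ?_
    filter_upwards [eventually_levelIndex_eq ht d, eventually_levelIndex_eq ht (d + 1),
      eventually_levelIndex_eq ht (d - 1), eventually_ge_atTop 1] with N e0 e1 e2 hN
    have h0 := qScale_pos lam N
    have h1 := qScale_lt_one hlam hN
    have a0 : levelIndex t d N = levelIndex t (d - 1) N + 1 := by omega
    have a1 : levelIndex t (d + 1) N = levelIndex t (d - 1) N + 2 := by omega
    set q := qScale lam N
    have hc := continuous_orthonormal q
    rw [← latticeMean_const_mul, ← latticeMean_const_mul,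
      ← latticeMean_add h0 h1 (by fun_prop) (by fun_prop), a0, a1]
    congr 1
    ext x
    have := mul_orthonormal_succ h0 h1 (levelIndex t (d - 1) N) x
    linear_combination -(endpoint lam N * (endpoint lam N * x) ^ m *
      orthonormal q (levelIndex t 0 N) x) * this

lemma levelIndex_zero (t : ℝ) (N : ℕ) : levelIndex t 0 N = ⌊t * N⌋₊ := by simp [levelIndex]

open Polynomial.Chebyshev in
/-- The mean of `f` under the arcsine law on `[-2b, 2b]`. -/
def arcsineMean (b : ℝ) (f : ℝ → ℝ) : ℝ := 1 / Real.pi * ∫ y, f (2 * b * y) ∂measureT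

open Polynomial.Chebyshev in
lemma tendsto_orthoMean_eval {lam : ℝ} (hlam : 0 < lam) {t : ℝ} (ht : 0 < t)
    (P : Polynomial ℝ) :
    Tendsto (fun N : ℕ => orthoMean (qScale lam N) ⌊t * N⌋₊ (fun x => P.eval (endpoint lam N * x)))
      atTop (𝓝 (arcsineMean (arcsineScale lam t) fun x => P.eval x)) := by
  have e : arcsineMean (arcsineScale lam t) (fun x => P.eval x) =
      ∑ i ∈ Finset.range (P.natDegree + 1),
        P.coeff i * arcsineMoment (arcsineScale lam t) i 0 := by
    simp only [arcsineMean, arcsineMoment, T_zero, Polynomial.eval_one, mul_one]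
    simp only [Polynomial.eval_eq_sum_range]
    rw [integral_finsetSum _ fun i _ => integrable_measureT (by fun_prop), Finset.mul_sum]
    refine Finset.sum_congr rfl fun i _ => ?_
    rw [integral_const_mul]; ring
  rw [e]
  refine (tendsto_finsetSum _ fun i _ =>
    (tendsto_latticeMean_walk hlam ht i 0).const_mul (P.coeff i)).congr' ?_
  filter_upwards [eventually_ge_atTop 1] with N hN
  have h0 := qScale_pos lam N
  have h1 := qScale_lt_one hlam hN
  have hc := continuous_orthonormal (qScale lam N)
  simp only [← latticeMean_const_mul]
  rw [← latticeMean_sum h0 h1 _ fun i => by fun_prop, orthoMean]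
  congr 1
  ext x
  rw [levelIndex_zero, Polynomial.eval_eq_sum_range, Finset.sum_mul]
  exact Finset.sum_congr rfl fun i _ => by ring

open Polynomial.Chebyshev in
lemma abs_arcsineMean_sub_le {b R ε : ℝ} (hb : 0 ≤ b) (hbR : 2 * b ≤ R) {f g : ℝ → ℝ}
    (hf : Continuous f) (hg : Continuous g) (h : ∀ x, |x| ≤ R → |f x - g x| ≤ ε) :
    |arcsineMean b f - arcsineMean b g| ≤ ε := by
  have hpi := Real.pi_pos
  rw [arcsineMean, arcsineMean, ← mul_sub, integral_measureT_eq_integral_cos,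
    integral_measureT_eq_integral_cos, ← intervalIntegral.integral_sub
      (Continuous.intervalIntegrable (by fun_prop) _ _)
      (Continuous.intervalIntegrable (by fun_prop) _ _), abs_mul, abs_of_pos (one_div_pos.2 hpi)]
  have := intervalIntegral.norm_integral_le_of_norm_le_const (a := 0) (b := Real.pi) (C := ε)
    (f := fun θ => f (2 * b * Real.cos θ) - g (2 * b * Real.cos θ)) fun θ _ => by
      refine h _ ?_
      rw [abs_mul, abs_of_nonneg (by positivity : 0 ≤ 2 * b)]
      have := Real.abs_cos_le_one θ
      nlinarith
  rw [sub_zero, abs_of_pos hpi, Real.norm_eq_abs] at this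
  rw [one_div_mul_eq_div, div_le_iff₀ hpi]
  exact this

lemma abs_orthoMean_comp_sub_le {lam : ℝ} (hlam : 0 < lam) {N : ℕ} (hN : 1 ≤ N) (n : ℕ) {ε : ℝ}
    {f g : ℝ → ℝ} (hf : Continuous f) (hg : Continuous g)
    (h : ∀ x, |x| ≤ radius lam → |f x - g x| ≤ ε) :
    |orthoMean (qScale lam N) n (fun x => f (endpoint lam N * x)) -
      orthoMean (qScale lam N) n (fun x => g (endpoint lam N * x))| ≤ ε := by
  have h0 := qScale_pos lam N
  have h1 := qScale_lt_one hlam hN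
  rw [← orthoMean_sub h0 h1 n (by fun_prop) (by fun_prop)]
  refine abs_orthoMean_le h0 h1 n (by fun_prop) fun x hx => h _ ?_
  have hp := endpoint_pos hlam hN
  rw [abs_mul, abs_of_pos hp]
  have := endpoint_le_radius hlam hN
  nlinarith

/-- Weierstrass approximation on [-radius, radius], which contains all the supports, reduces the
claim to polynomials. -/
lemma tendsto_orthoMean {lam : ℝ} (hlam : 0 < lam) {t : ℝ} (ht : 0 < t) {f : ℝ → ℝ}
    (hf : Continuous f) :
    Tendsto (fun N : ℕ => orthoMean (qScale lam N) ⌊t * N⌋₊ (fun x => f (endpoint lam N * x)))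
      atTop (𝓝 (arcsineMean (arcsineScale lam t) f)) := by
  rw [Metric.tendsto_atTop']
  intro ε hε
  obtain ⟨P, hP⟩ := exists_polynomial_near_of_continuousOn (-radius lam) (radius lam) f
    hf.continuousOn (ε / 3) (by positivity)
  have hP' : ∀ x, |x| ≤ radius lam → |f x - P.eval x| ≤ ε / 3 := fun x hx => by
    rw [abs_sub_comm]; exact (hP x (abs_le.1 hx)).le
  have h1 := abs_arcsineMean_sub_le (arcsineScale_nonneg lam t)
    ((two_mul_arcsineScale_le lam t).trans (one_div_sqrt_le_radius hlam)) hf P.continuous hP'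
  obtain ⟨M, hM⟩ := Metric.tendsto_atTop'.1 (tendsto_orthoMean_eval hlam ht P) (ε / 3)
    (by positivity)
  refine ⟨M, fun N hN => ?_⟩
  have h2 := hM N hN
  have h3 := abs_orthoMean_comp_sub_le hlam (Nat.one_le_of_lt hN) ⌊t * N⌋₊ hf P.continuous hP'
  rw [Real.dist_eq] at h2 ⊢
  rw [abs_le] at h1 h3
  rw [abs_lt] at h2 ⊢
  constructor <;> linarith

/-! ### Averages over the index as integrals -/

lemma ae_floor_eq (k : ℕ) (g : ℕ → ℝ) :
    (fun u : ℝ => g ⌊u⌋₊) =ᵐ[volume.restrict (Set.Ioc (k : ℝ) ((k + 1 : ℕ) : ℝ))] fun _ => g k := by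
  rw [Measure.restrict_congr_set Ioo_ae_eq_Ioc.symm]
  filter_upwards [ae_restrict_mem measurableSet_Ioo] with u hu
  have : ⌊u⌋₊ = k := by
    rw [Nat.floor_eq_iff ((Nat.cast_nonneg k).trans hu.1.le)]
    exact ⟨hu.1.le, by have := hu.2; push_cast at this; exact this⟩
  rw [this]

/-- The integrand is a step function with steps of length 1/N, so the index average becomes an
integral over a domain independent of N. -/
lemma average_eq_integral_floor {N : ℕ} (hN : 1 ≤ N) (g : ℕ → ℝ) :
    1 / N * ∑ j ∈ Finset.range N, g j = ∫ t in (0 : ℝ)..1, g ⌊t * N⌋₊ := by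
  have hN : (N : ℝ) ≠ 0 := by exact_mod_cast (Nat.one_le_iff_ne_zero.1 hN)
  rw [intervalIntegral.integral_comp_mul_right (fun u => g ⌊u⌋₊) hN, zero_mul, one_mul,
    smul_eq_mul, ← one_div]
  congr 1
  have hle : ∀ k : ℕ, (k : ℝ) ≤ ((k + 1 : ℕ) : ℝ) := fun k => by exact_mod_cast k.le_succ
  have := intervalIntegral.sum_integral_adjacent_intervals (μ := volume) (n := N)
    (a := fun k : ℕ => (k : ℝ)) (f := fun u : ℝ => g ⌊u⌋₊) fun k _ => by
      rw [intervalIntegrable_iff_integrableOn_Ioc_of_le (hle k), IntegrableOn,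
        integrable_congr (ae_floor_eq k g)]
      exact integrable_const _
  rw [Nat.cast_zero] at this
  rw [← this]
  refine Finset.sum_congr rfl fun k _ => ?_
  rw [intervalIntegral.integral_of_le (hle k), integral_congr_ae (ae_floor_eq k g)]
  simp

/-! ### The scaled density -/

lemma density_eq {q : ℝ} (h0 : 0 < q) (h1 : q < 1) (N : ℕ) (x : ℝ) :
    density q N x = 1 / (1 - q) *
      (∑ j ∈ Finset.range N, orthonormal q j x * orthonormal q j x) * weight q x := by
  rw [density]
  congr 2
  refine Finset.sum_congr rfl fun j _ => ?_
  rw [orthonormal, div_mul_div_comm, Real.mul_self_sqrt (sqNorm_pos h0 h1 j).le, sqNorm, sq]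

/-- The endpoint is chosen so that √(1 - q) √N c_N = 1: the scalings undo each other. -/
lemma endpoint_mul_scaledDensity {lam : ℝ} (hlam : 0 < lam) {N : ℕ} (hN : 1 ≤ N) (x : ℝ) :
    endpoint lam N * scaledDensity lam N (endpoint lam N * x) =
      1 / (N * (1 - qScale lam N)) * (∑ j ∈ Finset.range N,
        orthonormal (qScale lam N) j x * orthonormal (qScale lam N) j x) *
        weight (qScale lam N) x := by
  have h0 := qScale_pos lam N
  have h1 := qScale_lt_one hlam hN
  have hN' : (0 : ℝ) < N := by exact_mod_cast hN
  have hq : 0 < 1 - qScale lam N := by linarith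
  have a := Real.sqrt_pos.2 hN'
  have b := Real.sqrt_pos.2 hq
  have e : √(1 - qScale lam N) * (√N * (endpoint lam N * x)) = x := by
    rw [endpoint, Real.sqrt_mul hN'.le]
    field_simp
  rw [scaledDensity, densityHat, e, density_eq h0 h1, endpoint, Real.sqrt_mul hN'.le]
  have sN := Real.mul_self_sqrt hN'.le
  generalize √(1 - qScale lam N) = r at *
  generalize √(N : ℝ) = s at *
  rw [← sN]
  field_simp

/-- The integrand, on `[-1, 1]`, of the scaled Jackson integral. -/
def scaledIntegrand (lam : ℝ) (N : ℕ) (f : ℝ → ℝ) (x : ℝ) : ℝ :=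
  ∑ j ∈ Finset.range N,
    f (endpoint lam N * x) * (orthonormal (qScale lam N) j x * orthonormal (qScale lam N) j x)

lemma continuous_scaledIntegrand (lam : ℝ) (N : ℕ) {f : ℝ → ℝ} (hf : Continuous f) :
    Continuous (scaledIntegrand lam N f) := by
  have := continuous_orthonormal (qScale lam N)
  unfold scaledIntegrand
  fun_prop

lemma jackson_term_pos {lam : ℝ} (hlam : 0 < lam) {N : ℕ} (hN : 1 ≤ N) (f : ℝ → ℝ) (k : ℕ) :
    endpoint lam N * qScale lam N ^ k * (f (endpoint lam N * qScale lam N ^ k) *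
      scaledDensity lam N (endpoint lam N * qScale lam N ^ k)) =
    1 / (N * (1 - qScale lam N)) *
      (latticeMass (qScale lam N) k * scaledIntegrand lam N f (qScale lam N ^ k)) := by
  have := endpoint_mul_scaledDensity hlam hN (qScale lam N ^ k)
  rw [scaledIntegrand, ← Finset.mul_sum, latticeMass]
  linear_combination (qScale lam N ^ k * f (endpoint lam N * qScale lam N ^ k)) * this

/-- The minus sign is absorbed by the subtraction in the Jackson integral. -/
lemma jackson_term_neg {lam : ℝ} (hlam : 0 < lam) {N : ℕ} (hN : 1 ≤ N) (f : ℝ → ℝ) (k : ℕ) :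
    -endpoint lam N * qScale lam N ^ k * (f (-endpoint lam N * qScale lam N ^ k) *
      scaledDensity lam N (-endpoint lam N * qScale lam N ^ k)) =
    -(1 / (N * (1 - qScale lam N))) *
      (latticeMass (qScale lam N) k * scaledIntegrand lam N f (-qScale lam N ^ k)) := by
  have := endpoint_mul_scaledDensity hlam hN (-qScale lam N ^ k)
  rw [weight_neg] at this
  rw [scaledIntegrand, ← Finset.mul_sum, latticeMass, neg_mul_comm]
  linear_combination (-qScale lam N ^ k * f (endpoint lam N * -qScale lam N ^ k)) * this

lemma jacksonIntegrable_scaledDensity {lam : ℝ} (hlam : 0 < lam) {N : ℕ} (hN : 1 ≤ N) {f : ℝ → ℝ}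
    (hf : Continuous f) :
    JacksonIntegrable (qScale lam N) (fun x => f x * scaledDensity lam N x)
      (-endpoint lam N) (endpoint lam N) := by
  have h0 := qScale_pos lam N
  have h1 := qScale_lt_one hlam hN
  have hc := continuous_scaledIntegrand lam N hf
  constructor
  · simp only [jackson_term_neg hlam hN]
    exact (summable_latticeMass_mul_neg h0 h1 hc).mul_left _
  · simp only [jackson_term_pos hlam hN]
    exact (summable_latticeMass_mul h0 h1 hc).mul_left _

lemma jacksonIntegral_scaledDensity {lam : ℝ} (hlam : 0 < lam) {N : ℕ} (hN : 1 ≤ N) {f : ℝ → ℝ}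
    (hf : Continuous f) :
    jacksonIntegral (qScale lam N) (fun x => f x * scaledDensity lam N x)
      (-endpoint lam N) (endpoint lam N) =
    ∫ t in (0 : ℝ)..1,
      orthoMean (qScale lam N) ⌊t * N⌋₊ fun x => f (endpoint lam N * x) := by
  have h0 := qScale_pos lam N
  have h1 := qScale_lt_one hlam hN
  have hc := continuous_scaledIntegrand lam N hf
  have hN' : (N : ℝ) ≠ 0 := by exact_mod_cast (Nat.one_le_iff_ne_zero.1 hN)
  have hq : 1 - qScale lam N ≠ 0 := by linarith
  have ho := continuous_orthonormal (qScale lam N)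
  rw [← average_eq_integral_floor hN fun j =>
    orthoMean (qScale lam N) j fun x => f (endpoint lam N * x)]
  simp only [orthoMean]
  rw [← latticeMean_sum h0 h1 _ fun j => by fun_prop, latticeMean, jacksonIntegral, jacksonZero,
    jacksonZero]
  simp only [jackson_term_neg hlam hN, jackson_term_pos hlam hN]
  rw [tsum_mul_left, tsum_mul_left]
  have : ∑' k, latticeMass (qScale lam N) k * (scaledIntegrand lam N f (qScale lam N ^ k) +
      scaledIntegrand lam N f (-qScale lam N ^ k)) =
      ∑' k, latticeMass (qScale lam N) k * scaledIntegrand lam N f (qScale lam N ^ k) +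
      ∑' k, latticeMass (qScale lam N) k * scaledIntegrand lam N f (-qScale lam N ^ k) := by
    rw [← (summable_latticeMass_mul h0 h1 hc).tsum_add (summable_latticeMass_mul_neg h0 h1 hc)]
    simp only [mul_add]
  simp only [scaledIntegrand] at this ⊢
  rw [this]
  field_simp
  ring

/-- Dominated convergence in t, the bound being that of |f| on [-radius, radius]. -/
lemma tendsto_jacksonIntegral {lam : ℝ} (hlam : 0 < lam) {f : ℝ → ℝ} (hf : Continuous f) :
    Tendsto (fun N : ℕ => jacksonIntegral (qScale lam N) (fun x => f x * scaledDensity lam N x)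
      (-endpoint lam N) (endpoint lam N)) atTop
      (𝓝 (∫ t in (0 : ℝ)..1, arcsineMean (arcsineScale lam t) f)) := by
  obtain ⟨C, hC⟩ := exists_abs_le_of_continuous hf (radius lam)
  have key : Tendsto (fun N : ℕ => ∫ t in (0 : ℝ)..1,
      orthoMean (qScale lam N) ⌊t * N⌋₊ fun x => f (endpoint lam N * x)) atTop
      (𝓝 (∫ t in (0 : ℝ)..1, arcsineMean (arcsineScale lam t) f)) := by
    refine intervalIntegral.tendsto_integral_filter_of_dominated_convergence (fun _ => C)
      ?_ ?_ intervalIntegrable_const ?_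
    · refine Eventually.of_forall fun N => Measurable.aestronglyMeasurable ?_
      exact (measurable_from_nat (f := fun n => orthoMean (qScale lam N) n
        fun x => f (endpoint lam N * x))).comp
        (Nat.measurable_floor.comp (measurable_id.mul_const _))
    · filter_upwards [eventually_ge_atTop 1] with N hN
      refine Eventually.of_forall fun t _ => ?_
      refine abs_orthoMean_le (qScale_pos _ _) (qScale_lt_one hlam hN) _ (by fun_prop)
        fun x hx => hC _ ?_
      have hp := endpoint_pos hlam hN
      rw [abs_mul, abs_of_pos hp]
      have := endpoint_le_radius hlam hN
      nlinarith
    · refine Eventually.of_forall fun t ht => ?_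
      rw [Set.uIoc_of_le zero_le_one] at ht
      exact tendsto_orthoMean hlam ht.1 hf
  refine key.congr' ?_
  filter_upwards [eventually_ge_atTop 1] with N hN
  rw [jacksonIntegral_scaledDensity hlam hN hf]

/-! ### The mixture of arcsine laws -/

/-- The density, up to the factor `1 / π`, of the arcsine law at level `t`. -/
def arcsineKernel (lam t x : ℝ) : ℝ := 1 / √(4 * arcsineScale lam t ^ 2 - x ^ 2)

lemma measurable_arcsineScale (lam : ℝ) : Measurable (arcsineScale lam) := by
  unfold arcsineScale; fun_prop

lemma measurable_arcsineKernel (lam : ℝ) :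
    Measurable fun p : ℝ × ℝ => arcsineKernel lam p.1 p.2 := by
  have := measurable_arcsineScale lam
  unfold arcsineKernel
  fun_prop

/-- The measure `π ∫_0^1 (arcsine law at level t) dt`. -/
def arcsineMixture (lam : ℝ) : Measure ℝ :=
  ((volume.restrict (Set.Ioo (0 : ℝ) 1)).prod Polynomial.Chebyshev.measureT).map
    fun p => 2 * arcsineScale lam p.1 * p.2

instance isFiniteMeasure_measureT : IsFiniteMeasure Polynomial.Chebyshev.measureT := by
  have := Polynomial.Chebyshev.integrable_measureT (f := fun _ => (1 : ℝ)) continuousOn_const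
  rw [integrable_const_iff] at this
  simpa using this

lemma arcsineScale_pos {lam : ℝ} (hlam : 0 < lam) {t : ℝ} (ht : 0 < t) :
    0 < arcsineScale lam t := by
  have h1 : Real.exp (-(lam * t)) < 1 := Real.exp_lt_one_iff.2 (by have := mul_pos hlam ht; linarith)
  have := Real.exp_pos (-(lam * t))
  exact div_pos (Real.sqrt_pos.2 (mul_pos this (by linarith))) (Real.sqrt_pos.2 hlam)

/-- No indicator is needed: outside (-1, 1) the root is 0 and `1 / 0 = 0`. -/
lemma lintegral_measureT (g : ℝ → ENNReal) (hg : Measurable g) :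
    ∫⁻ y, g y ∂Polynomial.Chebyshev.measureT =
      ∫⁻ y, ENNReal.ofReal (1 / √(1 - y ^ 2)) * g y := by
  rw [Polynomial.Chebyshev.measureT, restrict_withDensity measurableSet_Ioc,
    lintegral_withDensity_eq_lintegral_mul _ (by fun_prop) hg, ← lintegral_indicator
      measurableSet_Ioc]
  refine lintegral_congr fun y => ?_
  by_cases hy : y ∈ Set.Ioc (-1 : ℝ) 1
  · rw [Set.indicator_of_mem hy, Pi.mul_apply, one_div, ← Real.sqrt_inv]
    congr 1
    rw [← ENNReal.ofReal_coe_nnreal]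
    rfl
  · rw [Set.indicator_of_notMem hy]
    have : √(1 - y ^ 2) = 0 := by
      refine Real.sqrt_eq_zero_of_nonpos ?_
      simp only [Set.mem_Ioc, not_and_or, not_lt, not_le] at hy
      rcases hy with hy | hy <;> nlinarith
    simp [this]

lemma lintegral_measureT_comp_mul {b : ℝ} (hb : 0 < b) (g : ℝ → ENNReal) (hg : Measurable g) :
    ∫⁻ y, g (2 * b * y) ∂Polynomial.Chebyshev.measureT =
      ∫⁻ x, ENNReal.ofReal (1 / √(4 * b ^ 2 - x ^ 2)) * g x := by
  have hb2 : 0 < 2 * b := by positivity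
  rw [lintegral_measureT _ (by fun_prop)]
  have h := Real.smul_map_volume_mul_left hb2.ne'
  conv_rhs => rw [← h, lintegral_smul_measure, lintegral_map (by fun_prop) (by fun_prop)]
  rw [smul_eq_mul, ← lintegral_const_mul _ (by fun_prop)]
  refine lintegral_congr fun y => ?_
  rw [← mul_assoc, ← ENNReal.ofReal_mul (abs_nonneg _), abs_of_pos hb2]
  congr 2
  have : 4 * b ^ 2 - (2 * b * y) ^ 2 = (2 * b) ^ 2 * (1 - y ^ 2) := by ring
  rw [this, Real.sqrt_mul (by positivity), Real.sqrt_sq hb2.le]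
  field_simp

lemma arcsineMixture_eq {lam : ℝ} (hlam : 0 < lam) :
    arcsineMixture lam = volume.withDensity fun x =>
      ∫⁻ t in Set.Ioo (0 : ℝ) 1, ENNReal.ofReal (arcsineKernel lam t x) := by
  have hs := measurable_arcsineScale lam
  have hk := measurable_arcsineKernel lam
  have hk' : Measurable fun x : ℝ =>
      ∫⁻ t in Set.Ioo (0 : ℝ) 1, ENNReal.ofReal (arcsineKernel lam t x) :=
    Measurable.lintegral_prod_left' (f := fun p : ℝ × ℝ =>
      ENNReal.ofReal (arcsineKernel lam p.1 p.2)) (by fun_prop)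
  refine Measure.ext_of_lintegral _ fun g hg => ?_
  rw [arcsineMixture, lintegral_map hg (by fun_prop), lintegral_prod _ (by fun_prop),
    lintegral_withDensity_eq_lintegral_mul _ hk' hg]
  have e1 : ∫⁻ t in Set.Ioo (0 : ℝ) 1, ∫⁻ y, g (2 * arcsineScale lam t * y)
      ∂Polynomial.Chebyshev.measureT = ∫⁻ t in Set.Ioo (0 : ℝ) 1, ∫⁻ x,
        ENNReal.ofReal (arcsineKernel lam t x) * g x :=
    setLIntegral_congr_fun measurableSet_Ioo fun t ht =>
      lintegral_measureT_comp_mul (arcsineScale_pos hlam ht.1) g hg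
  rw [e1, lintegral_lintegral_swap (by unfold Function.uncurry; fun_prop)]
  refine lintegral_congr fun x => ?_
  rw [Pi.mul_apply, lintegral_mul_const _ (by
    exact (hk.comp (measurable_id.prodMk measurable_const)).ennreal_ofReal)]

lemma ae_measureT_abs_le : ∀ᵐ y ∂Polynomial.Chebyshev.measureT, |y| ≤ 1 := by
  rw [Polynomial.Chebyshev.measureT]
  filter_upwards [ae_restrict_mem measurableSet_Ioc] with y hy
  exact abs_le.2 ⟨hy.1.le, hy.2⟩

lemma integrable_comp_arcsineScale {lam : ℝ} (hlam : 0 < lam) {f : ℝ → ℝ} (hf : Continuous f) :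
    Integrable (fun p : ℝ × ℝ => f (2 * arcsineScale lam p.1 * p.2))
      ((volume.restrict (Set.Ioo (0 : ℝ) 1)).prod Polynomial.Chebyshev.measureT) := by
  have hs := measurable_arcsineScale lam
  obtain ⟨C, hC⟩ := exists_abs_le_of_continuous hf (radius lam)
  refine Integrable.of_bound (by fun_prop) C ?_
  filter_upwards [Measure.quasiMeasurePreserving_snd.ae ae_measureT_abs_le] with p hp
  refine hC _ ?_
  have h1 := arcsineScale_nonneg lam p.1
  have h2 := (two_mul_arcsineScale_le lam p.1).trans (one_div_sqrt_le_radius hlam)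
  rw [abs_mul, abs_of_nonneg (by positivity : 0 ≤ 2 * arcsineScale lam p.1)]
  nlinarith

/-- Tonelli gives the mixture the density ∫ `arcsineKernel` dt. An almost everywhere formula for it
suffices, so the edges and x = 0 may be ignored. -/
lemma integral_arcsineMean {lam : ℝ} (hlam : 0 < lam) {f r : ℝ → ℝ} (hf : Continuous f)
    (hr : ∀ᵐ x, 0 ≤ r x ∧ ∫⁻ t in Set.Ioo (0 : ℝ) 1, ENNReal.ofReal (arcsineKernel lam t x) =
      ENNReal.ofReal (Real.pi * r x)) :
    Integrable (fun x => f x * r x) ∧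
      ∫ t in (0 : ℝ)..1, arcsineMean (arcsineScale lam t) f = ∫ x, f x * r x := by
  have hs := measurable_arcsineScale lam
  have hk := measurable_arcsineKernel lam
  have hk' : Measurable fun x : ℝ =>
      ∫⁻ t in Set.Ioo (0 : ℝ) 1, ENNReal.ofReal (arcsineKernel lam t x) :=
    Measurable.lintegral_prod_left' (f := fun p : ℝ × ℝ =>
      ENNReal.ofReal (arcsineKernel lam p.1 p.2)) (by fun_prop)
  have hpi := Real.pi_pos
  have hfin : ∀ᵐ x : ℝ,
      ∫⁻ t in Set.Ioo (0 : ℝ) 1, ENNReal.ofReal (arcsineKernel lam t x) < ⊤ := by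
    filter_upwards [hr] with x hx
    rw [hx.2]; exact ENNReal.ofReal_lt_top
  have hae : (fun x : ℝ => (∫⁻ t in Set.Ioo (0 : ℝ) 1,
      ENNReal.ofReal (arcsineKernel lam t x)).toReal • f x) =ᵐ[volume]
      fun x => Real.pi * (f x * r x) := by
    filter_upwards [hr] with x hx
    rw [hx.2, ENNReal.toReal_ofReal (mul_nonneg hpi.le hx.1), smul_eq_mul]; ring
  have hint := integrable_comp_arcsineScale hlam hf
  have hmap : Integrable f (arcsineMixture lam) := by
    rw [arcsineMixture, integrable_map_measure hf.aestronglyMeasurable (by fun_prop)]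
    exact hint
  have hval : ∫ x, f x ∂arcsineMixture lam = ∫ t in Set.Ioo (0 : ℝ) 1,
      ∫ y, f (2 * arcsineScale lam t * y) ∂Polynomial.Chebyshev.measureT := by
    rw [arcsineMixture, integral_map (by fun_prop) hf.aestronglyMeasurable, integral_prod _ hint]
  rw [arcsineMixture_eq hlam] at hmap hval
  rw [integrable_withDensity_iff_integrable_smul' hk' hfin, integrable_congr hae] at hmap
  rw [integral_withDensity_eq_integral_toReal_smul hk' hfin, integral_congr_ae hae,
    integral_const_mul] at hval
  constructor
  · have := hmap.const_mul (1 / Real.pi)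
    simpa only [← mul_assoc, one_div_mul_cancel hpi.ne', one_mul] using this
  · simp only [arcsineMean]
    rw [intervalIntegral.integral_const_mul, intervalIntegral.integral_of_le zero_le_one,
      integral_Ioc_eq_integral_Ioo, ← hval]
    field_simp

/-! ### Integration over the level -/

/-- Nonnegativity of the derivative supplies integrability, as needed for a kernel that may blow up
at the ends of its window. The inequality later yields nonnegativity of the limit density. -/
lemma lintegral_ofReal_deriv {a b : ℝ} (hab : a ≤ b) {g g' : ℝ → ℝ}
    (hc : ContinuousOn g (Set.Icc a b)) (hd : ∀ t ∈ Set.Ioo a b, HasDerivAt g (g' t) t)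
    (hpos : ∀ t ∈ Set.Ioo a b, 0 ≤ g' t) :
    g a ≤ g b ∧ ∫⁻ t in Set.Ioo a b, ENNReal.ofReal (g' t) = ENNReal.ofReal (g b - g a) := by
  have hi := intervalIntegral.integrableOn_deriv_of_nonneg hc hd hpos
  have hv := intervalIntegral.integral_eq_sub_of_hasDerivAt_of_le hab hc hd
    ((intervalIntegrable_iff_integrableOn_Ioc_of_le hab).2 hi)
  rw [intervalIntegral.integral_of_le hab, integral_Ioc_eq_integral_Ioo] at hv
  have hnn : 0 ≤ᵐ[volume.restrict (Set.Ioo a b)] g' := by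
    filter_upwards [ae_restrict_mem measurableSet_Ioo] with t ht using hpos t ht
  constructor
  · have := integral_nonneg_of_ae hnn
    linarith
  · rw [← hv, ofReal_integral_eq_lintegral_ofReal (hi.mono_set Set.Ioo_subset_Ioc_self) hnn]

/-- The argument of `2 s - v + i √(4 s (1 - s) - v²)`, extended continuously to all `s > 0`. -/
def angle (v s : ℝ) : ℝ := Real.arccos ((2 * s - v) / (2 * √(s * (1 - v))))

lemma hasDerivAt_angle {v s : ℝ} (hs : 0 < s) (hv : v < 1) (h : v ^ 2 < 4 * s * (1 - s)) :
    HasDerivAt (angle v) (-((2 * s + v) / (2 * s * √(4 * s * (1 - s) - v ^ 2)))) s := by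
  have hv' : 0 < 1 - v := by linarith
  have hw2 : 0 < s * (1 - v) := mul_pos hs hv'
  have hw := Real.sqrt_pos.2 hw2
  have hR := Real.sqrt_pos.2 (show 0 < 4 * s * (1 - s) - v ^ 2 by linarith)
  have sw := Real.sq_sqrt hw2.le
  have sR := Real.sq_sqrt (show 0 ≤ 4 * s * (1 - s) - v ^ 2 by linarith)
  have d1 : HasDerivAt (fun s => √(s * (1 - v))) ((1 - v) / (2 * √(s * (1 - v)))) s := by
    have := ((hasDerivAt_id s).mul_const (1 - v)).sqrt hw2.ne'
    simpa using this
  have d2 : HasDerivAt (fun s => (2 * s - v) / (2 * √(s * (1 - v))))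
      ((2 * (2 * √(s * (1 - v))) - (2 * s - v) * (2 * ((1 - v) / (2 * √(s * (1 - v)))))) /
        (2 * √(s * (1 - v))) ^ 2) s := by
    have n1 : HasDerivAt (fun s => 2 * s - v) 2 s := by
      simpa using ((hasDerivAt_id s).const_mul 2).sub_const v
    exact n1.div (d1.const_mul 2) (by positivity)
  set w := √(s * (1 - v))
  set R := √(4 * s * (1 - s) - v ^ 2)
  -- Here (2s - v)² + R² = 4s(1 - v), so R/(2w) is the sine of the angle.
  have sq : 1 - ((2 * s - v) / (2 * w)) ^ 2 = (R / (2 * w)) ^ 2 := by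
    field_simp
    rw [sR, sw]; ring
  have hlt : ((2 * s - v) / (2 * w)) ^ 2 < 1 := by
    have : 0 < (R / (2 * w)) ^ 2 := by positivity
    linarith
  have d3 := Real.hasDerivAt_arccos (x := (2 * s - v) / (2 * w))
    (fun e => by rw [e] at hlt; norm_num at hlt) (fun e => by rw [e] at hlt; norm_num at hlt)
  have d4 := d3.comp s d2
  rw [sq, Real.sqrt_sq (by positivity)] at d4
  refine d4.congr_deriv ?_
  field_simp
  rw [sw]
  field_simp
  ring

lemma continuousOn_angle {v : ℝ} (hv : v < 1) : ContinuousOn (angle v) (Set.Ioi 0) := by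
  unfold angle
  refine Real.continuous_arccos.comp_continuousOn (ContinuousOn.div (by fun_prop) (by fun_prop) ?_)
  intro s hs
  have : 0 < s * (1 - v) := mul_pos hs (by linarith)
  have := Real.sqrt_pos.2 this
  positivity

/-- At the ends of the window R = 0 and the complex number is real, so only its sign matters. -/
lemma angle_eq_of_sq_eq {v s : ℝ} (hs : 0 < s) (hv : v < 1) (h : v ^ 2 = 4 * s * (1 - s)) :
    angle v s = if v < 2 * s then 0 else Real.pi := by
  have hw2 : 0 < s * (1 - v) := mul_pos hs (by linarith)
  have e : (2 * s - v) ^ 2 = 4 * (s * (1 - v)) := by linear_combination h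
  have e2 : 2 * √(s * (1 - v)) = |2 * s - v| := by
    rw [← Real.sqrt_sq_eq_abs, e, show (4 : ℝ) = 2 ^ 2 by norm_num,
      Real.sqrt_mul (sq_nonneg 2), Real.sqrt_sq two_pos.le]
  have hne : 2 * s - v ≠ 0 := fun h0 => by rw [h0] at e; nlinarith
  rw [angle, e2]
  split_ifs with hlt
  · rw [abs_of_pos (by linarith), div_self hne, Real.arccos_one]
  · rw [abs_of_nonpos (by linarith), div_neg, div_self hne, Real.arccos_neg_one]

/-- The angle difference at level `t`, an antiderivative of the arcsine kernel. -/
def levelAngle (lam v t : ℝ) : ℝ :=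
  angle v (Real.exp (-(lam * t))) - angle (-v) (Real.exp (-(lam * t)))

lemma continuous_levelAngle {v : ℝ} (lam : ℝ) (h1 : -1 < v) (h2 : v < 1) :
    Continuous (levelAngle lam v) := by
  have he : Continuous fun t : ℝ => Real.exp (-(lam * t)) := by fun_prop
  exact ((continuousOn_angle h2).comp_continuous he fun t => Real.exp_pos _).sub
    ((continuousOn_angle (by linarith)).comp_continuous he fun t => Real.exp_pos _)

/-- In the difference of the two s-derivatives only -v/(sR) survives, and ds/dt = -λs cancels the
remaining `s`. -/
lemma hasDerivAt_levelAngle {lam v t : ℝ} (h1 : -1 < v) (h2 : v < 1)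
    (h : v ^ 2 < 4 * Real.exp (-(lam * t)) * (1 - Real.exp (-(lam * t)))) :
    HasDerivAt (levelAngle lam v) (lam * v /
      √(4 * Real.exp (-(lam * t)) * (1 - Real.exp (-(lam * t))) - v ^ 2)) t := by
  have he : HasDerivAt (fun t : ℝ => Real.exp (-(lam * t)))
      (Real.exp (-(lam * t)) * -lam) t := by
    simpa using ((hasDerivAt_id t).const_mul lam).neg.exp
  have hs := Real.exp_pos (-(lam * t))
  have d1 := (hasDerivAt_angle hs h2 h).comp t he
  have d2 := (hasDerivAt_angle (v := -v) hs (by linarith) (by rwa [neg_sq])).comp t he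
  refine (d1.sub d2).congr_deriv ?_
  have hR := Real.sqrt_pos.2 (show 0 < 4 * Real.exp (-(lam * t)) * (1 - Real.exp (-(lam * t))) -
    v ^ 2 by linarith)
  rw [neg_sq]
  field_simp
  ring

lemma arcsineKernel_eq {lam : ℝ} (hlam : 0 < lam) {t : ℝ} (ht : 0 < t) (x : ℝ) :
    arcsineKernel lam t x = √lam /
      √(4 * Real.exp (-(lam * t)) * (1 - Real.exp (-(lam * t))) - (√lam * x) ^ 2) := by
  have h1 : Real.exp (-(lam * t)) < 1 :=
    Real.exp_lt_one_iff.2 (by have := mul_pos hlam ht; linarith)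
  have h2 := Real.exp_pos (-(lam * t))
  have sl := Real.sq_sqrt hlam.le
  rw [arcsineKernel, arcsineScale, div_pow, Real.sq_sqrt (mul_nonneg h2.le (by linarith)), sl]
  have : 4 * (Real.exp (-(lam * t)) * (1 - Real.exp (-(lam * t))) / lam) - x ^ 2 =
      (4 * Real.exp (-(lam * t)) * (1 - Real.exp (-(lam * t))) - (√lam * x) ^ 2) / lam := by
    rw [mul_pow, sl]; field_simp
  rw [this, Real.sqrt_div' _ hlam.le, one_div_div]

/-- The level at which the exponential `e^(-λ t)` takes the value `s`. -/
def levelOf (lam s : ℝ) : ℝ := -Real.log s / lam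

lemma exp_levelOf {lam s : ℝ} (hlam : 0 < lam) (hs : 0 < s) :
    Real.exp (-(lam * levelOf lam s)) = s := by
  rw [levelOf, mul_div_cancel₀ _ hlam.ne', neg_neg, Real.exp_log hs]

lemma lt_levelOf_iff {lam s t : ℝ} (hlam : 0 < lam) (hs : 0 < s) :
    t < levelOf lam s ↔ s < Real.exp (-(lam * t)) := by
  rw [levelOf, lt_div_iff₀ hlam, ← Real.log_lt_iff_lt_exp hs]
  constructor <;> intro h <;> linarith

lemma levelOf_lt_iff {lam s t : ℝ} (hlam : 0 < lam) (hs : 0 < s) :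
    levelOf lam s < t ↔ Real.exp (-(lam * t)) < s := by
  rw [levelOf, div_lt_iff₀ hlam, ← Real.lt_log_iff_exp_lt hs]
  constructor <;> intro h <;> linarith

lemma lintegral_arcsineKernel_eq_zero {lam : ℝ} (hlam : 0 < lam) {x : ℝ}
    (h : ∀ t ∈ Set.Ioo (0 : ℝ) 1,
      4 * Real.exp (-(lam * t)) * (1 - Real.exp (-(lam * t))) ≤ (√lam * x) ^ 2) :
    ∫⁻ t in Set.Ioo (0 : ℝ) 1, ENNReal.ofReal (arcsineKernel lam t x) = 0 := by
  rw [setLIntegral_congr_fun (g := fun _ => 0) measurableSet_Ioo]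
  · simp
  · intro t ht
    have := h t ht
    simp only
    rw [arcsineKernel_eq hlam ht.1, Real.sqrt_eq_zero_of_nonpos (sub_nonpos.2 this)]
    simp

/-! ### The level integral at a fixed point, regime by regime. -/

section Inner

variable {lam x : ℝ}

/-- `x` lies in the support of the arcsine law at level `t` exactly when `t` belongs to an explicit
interval. -/
lemma sq_lt_iff_mem_levels (hlam : 0 < lam) (hx0 : x ≠ 0) (hx : (√lam * x) ^ 2 < 1) (t : ℝ) :
    (√lam * x) ^ 2 < 4 * Real.exp (-(lam * t)) * (1 - Real.exp (-(lam * t))) ↔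
      t ∈ Set.Ioo (levelOf lam ((1 + √(1 - (√lam * x) ^ 2)) / 2))
        (levelOf lam ((1 - √(1 - (√lam * x) ^ 2)) / 2)) := by
  have hv0 : 0 < (√lam * x) ^ 2 := by
    have := Real.sqrt_pos.2 hlam
    positivity
  generalize (√lam * x) ^ 2 = V at *
  have u0 : 0 ≤ √(1 - V) := Real.sqrt_nonneg _
  have su := Real.sq_sqrt (show 0 ≤ 1 - V by linarith)
  have u1 : √(1 - V) < 1 := by nlinarith
  rw [Set.mem_Ioo, levelOf_lt_iff hlam (by linarith), lt_levelOf_iff hlam (by linarith)]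
  generalize Real.exp (-(lam * t)) = s at *
  -- Completing the square: 4s(1 - s) = 1 - (2s - 1)².
  have : V < 4 * s * (1 - s) ↔ |2 * s - 1| < √(1 - V) := by
    rw [Real.lt_sqrt (abs_nonneg _), sq_abs]
    constructor <;> intro h <;> nlinarith
  rw [this, abs_lt]
  constructor <;> rintro ⟨h1, h2⟩ <;> constructor <;> linarith

/-- The hypotheses make `b` the smaller of 1 and the closing level. At the opening level 2s = 1 + u
> |v|, so both angles are 0 and only the value at `b` remains. -/
lemma lintegral_arcsineKernel_of_le (hlam : 0 < lam) (hx0 : x ≠ 0) (hx : (√lam * x) ^ 2 < 1)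
    {b : ℝ} (hb1 : b ≤ 1) (hb : b ≤ levelOf lam ((1 - √(1 - (√lam * x) ^ 2)) / 2))
    (hb' : b = 1 ∨ b = levelOf lam ((1 - √(1 - (√lam * x) ^ 2)) / 2))
    (hab : levelOf lam ((1 + √(1 - (√lam * x) ^ 2)) / 2) ≤ b) :
    0 ≤ levelAngle lam (√lam * x) b / (lam * x) ∧
    ∫⁻ t in Set.Ioo (0 : ℝ) 1, ENNReal.ofReal (arcsineKernel lam t x) =
      ENNReal.ofReal (levelAngle lam (√lam * x) b / (lam * x)) := by
  have mem := sq_lt_iff_mem_levels hlam hx0 hx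
  have hv := abs_lt.1 ((sq_lt_one_iff_abs_lt_one _).1 hx)
  have hl := Real.sqrt_pos.2 hlam
  have hv0 : 0 < (√lam * x) ^ 2 := by positivity
  have u0 : 0 ≤ √(1 - (√lam * x) ^ 2) := Real.sqrt_nonneg _
  have su := Real.sq_sqrt (show 0 ≤ 1 - (√lam * x) ^ 2 by linarith)
  have u1 : √(1 - (√lam * x) ^ 2) < 1 := by nlinarith
  set u := √(1 - (√lam * x) ^ 2) with hu
  set a := levelOf lam ((1 + u) / 2) with ha
  set c := levelOf lam ((1 - u) / 2) with hc
  have a0 : 0 < a := by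
    rw [ha, lt_levelOf_iff hlam (by linarith), mul_zero, neg_zero, Real.exp_zero]; linarith
  have ga : levelAngle lam (√lam * x) a = 0 := by
    rw [levelAngle, ha, exp_levelOf hlam (by linarith), angle_eq_of_sq_eq (by linarith) hv.2
      (by linear_combination su), angle_eq_of_sq_eq (by linarith) (by linarith)
      (by linear_combination su), if_pos (by linarith), if_pos (by linarith), sub_self]
  have key := lintegral_ofReal_deriv (g := fun t => levelAngle lam (√lam * x) t / (lam * x))
    (g' := fun t => √lam / √(4 * Real.exp (-(lam * t)) * (1 - Real.exp (-(lam * t))) -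
      (√lam * x) ^ 2)) hab
    ((continuous_levelAngle lam hv.1 hv.2).div_const _).continuousOn
    (fun t ht => by
      refine ((hasDerivAt_levelAngle hv.1 hv.2
        ((mem t).2 ⟨ht.1, ht.2.trans_le hb⟩)).div_const (lam * x)).congr_deriv ?_
      field_simp)
    (fun t _ => by positivity)
  simp only [ga, zero_div, sub_zero] at key
  refine ⟨key.1, ?_⟩
  rw [← key.2]
  have hsub : Set.Ioo a b ⊆ Set.Ioo (0 : ℝ) 1 := Set.Ioo_subset_Ioo a0.le hb1
  rw [← lintegral_indicator measurableSet_Ioo, ← lintegral_indicator measurableSet_Ioo]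
  refine lintegral_congr_ae ?_
  have hne : ∀ᵐ t : ℝ, t ≠ b := by simp [ae_iff]
  filter_upwards [hne] with t htb
  by_cases h1 : t ∈ Set.Ioo a b
  · rw [Set.indicator_of_mem h1, Set.indicator_of_mem (hsub h1), arcsineKernel_eq hlam (hsub h1).1]
  · rw [Set.indicator_of_notMem h1]
    by_cases h2 : t ∈ Set.Ioo (0 : ℝ) 1
    · rw [Set.indicator_of_mem h2, arcsineKernel_eq hlam h2.1]
      have : ¬ (t ∈ Set.Ioo a c) := fun h3 => h1 ⟨h3.1, by
        rcases hb' with rfl | h4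
        · exact h2.2
        · rw [h4]; exact h3.2⟩
      rw [← mem, not_lt] at this
      rw [Real.sqrt_eq_zero_of_nonpos (sub_nonpos.2 this)]
      simp
    · rw [Set.indicator_of_notMem h2]

lemma lintegral_arcsineKernel_inside (hlam : 0 < lam) (hx0 : x ≠ 0)
    (hx : (√lam * x) ^ 2 < 4 * Real.exp (-lam) * (1 - Real.exp (-lam))) :
    0 ≤ levelAngle lam (√lam * x) 1 / (lam * x) ∧
    ∫⁻ t in Set.Ioo (0 : ℝ) 1, ENNReal.ofReal (arcsineKernel lam t x) =
      ENNReal.ofReal (levelAngle lam (√lam * x) 1 / (lam * x)) := by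
  have hx1 : (√lam * x) ^ 2 < 1 := by nlinarith [sq_nonneg (2 * Real.exp (-lam) - 1)]
  have mem := sq_lt_iff_mem_levels hlam hx0 hx1 1
  rw [mul_one] at mem
  have := mem.1 hx
  exact lintegral_arcsineKernel_of_le hlam hx0 hx1 le_rfl this.2.le (Or.inl rfl) this.1.le

/-- The window closes no later than t = 1. At closing 2s = 1 - u ≤ |v|, so exactly one of the two
angles is π, the sign of `x` deciding which. -/
lemma lintegral_arcsineKernel_saturated (hlam : 0 < lam) (hx0 : x ≠ 0)
    (hE : Real.exp (-lam) ≤ 1 / 2) (hx1 : (√lam * x) ^ 2 < 1)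
    (hx : 4 * Real.exp (-lam) * (1 - Real.exp (-lam)) < (√lam * x) ^ 2) :
    ∫⁻ t in Set.Ioo (0 : ℝ) 1, ENNReal.ofReal (arcsineKernel lam t x) =
      ENNReal.ofReal (Real.pi / (lam * |x|)) := by
  have hv := abs_lt.1 ((sq_lt_one_iff_abs_lt_one _).1 hx1)
  have hl := Real.sqrt_pos.2 hlam
  have hv0 : 0 < (√lam * x) ^ 2 := by positivity
  have u0 : 0 < √(1 - (√lam * x) ^ 2) := Real.sqrt_pos.2 (by linarith)
  have su := Real.sq_sqrt (show 0 ≤ 1 - (√lam * x) ^ 2 by linarith)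
  have u1 : √(1 - (√lam * x) ^ 2) < 1 := by nlinarith
  have main := fun h1 h2 => (lintegral_arcsineKernel_of_le hlam hx0 hx1 (b := levelOf lam
    ((1 - √(1 - (√lam * x) ^ 2)) / 2)) h1 le_rfl (Or.inr rfl) h2).2
  set u := √(1 - (√lam * x) ^ 2)
  rw [main]
  · congr 1
    rw [levelAngle, exp_levelOf hlam (by linarith), angle_eq_of_sq_eq (by linarith) hv.2
      (by linear_combination su), angle_eq_of_sq_eq (by linarith) (by linarith)
      (by linear_combination su)]
    rcases lt_or_gt_of_ne hx0 with h | h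
    · have hn : √lam * x < 0 := mul_neg_of_pos_of_neg hl h
      -- Otherwise v² < (1 - u)², contradicting v² = (1 - u)(1 + u).
      have : 1 - u ≤ -(√lam * x) := by
        by_contra hcon
        have : (√lam * x) ^ 2 < (1 - u) ^ 2 := by nlinarith
        nlinarith
      rw [if_pos (by linarith), if_neg (by linarith), abs_of_neg h, zero_sub, mul_neg, div_neg,
        neg_div]
    · have hn : 0 < √lam * x := mul_pos hl h
      have : 1 - u ≤ √lam * x := by
        by_contra hcon
        have : (√lam * x) ^ 2 < (1 - u) ^ 2 := by nlinarith
        nlinarith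
      rw [if_neg (by linarith), if_pos (by linarith), abs_of_pos h, sub_zero]
  · rw [← not_lt, lt_levelOf_iff hlam (by linarith), mul_one, not_lt]
    -- If (1 - u)/2 < e^(-λ) ≤ 1/2, monotonicity of s(1 - s) below 1/2 contradicts `hx`.
    by_contra hcon
    nlinarith
  · rw [← not_lt, lt_levelOf_iff hlam (by linarith), exp_levelOf hlam (by linarith)]
    linarith

/-- Here s stays in [1/2, 1], where s(1 - s) decreases in s, so the arcsine supports grow with t and
the one at t = 1 contains the others. -/
lemma lintegral_arcsineKernel_outside (hlam : 0 < lam) (hE : 1 / 2 ≤ Real.exp (-lam))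
    (hx : 4 * Real.exp (-lam) * (1 - Real.exp (-lam)) < (√lam * x) ^ 2) :
    ∫⁻ t in Set.Ioo (0 : ℝ) 1, ENNReal.ofReal (arcsineKernel lam t x) = 0 := by
  refine lintegral_arcsineKernel_eq_zero hlam fun t ht => ?_
  have : Real.exp (-lam) ≤ Real.exp (-(lam * t)) :=
    Real.exp_le_exp.2 (by have := ht.2; nlinarith)
  nlinarith

lemma lintegral_arcsineKernel_far (hlam : 0 < lam) (hx : 1 ≤ (√lam * x) ^ 2) :
    ∫⁻ t in Set.Ioo (0 : ℝ) 1, ENNReal.ofReal (arcsineKernel lam t x) = 0 :=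
  lintegral_arcsineKernel_eq_zero hlam fun t _ => by
    nlinarith [sq_nonneg (2 * Real.exp (-(lam * t)) - 1)]

end Inner

/-! ### Identification of the limit density -/

lemma im_ofReal_add_I_mul (a b : ℝ) : ((a : ℂ) + Complex.I * (b : ℂ)).im = b := by simp

lemma arg_eq_angle {v s : ℝ} (h : v ^ 2 < 4 * s * (1 - s)) :
    Complex.arg (((2 * s - v : ℝ) : ℂ) + Complex.I * ((√(4 * s * (1 - s) - v ^ 2) : ℝ) : ℂ)) =
      angle v s := by
  have hR := Real.sqrt_pos.2 (show 0 < 4 * s * (1 - s) - v ^ 2 by linarith)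
  have sR := Real.mul_self_sqrt (show 0 ≤ 4 * s * (1 - s) - v ^ 2 by linarith)
  have hre : (((2 * s - v : ℝ) : ℂ) +
      Complex.I * ((√(4 * s * (1 - s) - v ^ 2) : ℝ) : ℂ)).re = 2 * s - v := by simp
  have him : (((2 * s - v : ℝ) : ℂ) +
      Complex.I * ((√(4 * s * (1 - s) - v ^ 2) : ℝ) : ℂ)).im = √(4 * s * (1 - s) - v ^ 2) :=
    im_ofReal_add_I_mul _ _
  rw [Complex.arg_of_im_pos (by rw [him]; exact hR), hre, angle, Complex.norm_def,
    Complex.normSq_apply, hre, him, sR]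
  congr 2
  rw [show (2 * s - v) * (2 * s - v) + (4 * s * (1 - s) - v ^ 2) = 2 ^ 2 * (s * (1 - v)) by ring,
    Real.sqrt_mul (sq_nonneg 2), Real.sqrt_sq two_pos.le]

/-- Both arguments lie in (0, π), so their difference lies in (-π, π) and no multiple of 2π
intervenes. -/
lemma arg_div_of_im_pos {z w : ℂ} (hz : 0 < z.im) (hw : 0 < w.im) :
    Complex.arg (z / w) = z.arg - w.arg := by
  have hz0 : z ≠ 0 := fun h => by simp [h] at hz
  have hw0 : w ≠ 0 := fun h => by simp [h] at hw
  have p1 := Complex.arg_nonneg_iff.2 hz.le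
  have p2 := Complex.arg_nonneg_iff.2 hw.le
  have p3 := Complex.arg_lt_pi_iff.2 (Or.inr hz.ne')
  have p4 := Complex.arg_lt_pi_iff.2 (Or.inr hw.ne')
  have h := Complex.arg_div_coe_angle hz0 hw0
  rw [← Real.Angle.coe_sub] at h
  have := congrArg Real.Angle.toReal h
  rwa [Complex.arg_coe_angle_toReal_eq_arg, Real.Angle.toReal_coe_eq_self_iff.2
    ⟨by linarith, by linarith⟩] at this

lemma mem_Ioo_edge_iff {lam : ℝ} (hlam : 0 < lam) (x : ℝ) :
    x ∈ Set.Ioo (-edge lam) (edge lam) ↔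
      (√lam * x) ^ 2 < 4 * Real.exp (-lam) * (1 - Real.exp (-lam)) := by
  have hl := Real.sqrt_pos.2 hlam
  rw [Set.mem_Ioo, ← abs_lt, edge, lt_div_iff₀ hl, ← abs_of_pos hl, ← abs_mul, abs_of_pos hl,
    mul_comm x]
  have e : 2 * √((1 - Real.exp (-lam)) * Real.exp (-lam)) =
      √(4 * Real.exp (-lam) * (1 - Real.exp (-lam))) := by
    rw [show 4 * Real.exp (-lam) * (1 - Real.exp (-lam)) =
      2 ^ 2 * ((1 - Real.exp (-lam)) * Real.exp (-lam)) by ring, Real.sqrt_mul (sq_nonneg 2),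
      Real.sqrt_sq two_pos.le]
  rw [e, Real.lt_sqrt (abs_nonneg _), sq_abs]

lemma mem_Ioo_one_div_sqrt_iff {lam : ℝ} (hlam : 0 < lam) (x : ℝ) :
    x ∈ Set.Ioo (-(1 / √lam)) (1 / √lam) ↔ (√lam * x) ^ 2 < 1 := by
  have hl := Real.sqrt_pos.2 hlam
  rw [Set.mem_Ioo, ← abs_lt, lt_div_iff₀ hl, sq_lt_one_iff_abs_lt_one, abs_mul, abs_of_pos hl,
    mul_comm]

lemma argDensity_inside {lam : ℝ} (hlam : 0 < lam) {x : ℝ}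
    (hx : (√lam * x) ^ 2 < 4 * Real.exp (-lam) * (1 - Real.exp (-lam))) :
    Real.pi * argDensity lam x = levelAngle lam (√lam * x) 1 / (lam * x) := by
  have hE := Real.exp_pos (-lam)
  have hx1 : (√lam * x) ^ 2 < 1 := by nlinarith [sq_nonneg (2 * Real.exp (-lam) - 1)]
  have hv := abs_lt.1 ((sq_lt_one_iff_abs_lt_one _).1 hx1)
  have e : 4 * (1 - Real.exp (-lam)) * Real.exp (-lam) - lam * x ^ 2 =
      4 * Real.exp (-lam) * (1 - Real.exp (-lam)) - (√lam * x) ^ 2 := by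
    rw [mul_pow, Real.sq_sqrt hlam.le]; ring
  have hR := Real.sqrt_pos.2 (show 0 < 4 * Real.exp (-lam) * (1 - Real.exp (-lam)) -
    (√lam * x) ^ 2 by linarith)
  have a1 := arg_eq_angle hx
  have a2 := arg_eq_angle (v := -(√lam * x)) (by rwa [neg_sq])
  rw [neg_sq, sub_neg_eq_add] at a2
  rw [argDensity, Set.indicator_of_mem ((mem_Ioo_edge_iff hlam x).2 hx), e,
    arg_div_of_im_pos (by rwa [im_ofReal_add_I_mul]) (by rwa [im_ofReal_add_I_mul]), a1, a2, levelAngle, mul_one]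
  field_simp

lemma argDensity_outside {lam : ℝ} (hlam : 0 < lam) {x : ℝ}
    (hx : 4 * Real.exp (-lam) * (1 - Real.exp (-lam)) < (√lam * x) ^ 2) : argDensity lam x = 0 := by
  rw [argDensity, Set.indicator_of_notMem]
  rw [mem_Ioo_edge_iff hlam]
  exact hx.not_gt

/-- Discards x = 0, where the formulas divide by zero, and the edges ±a(λ), so that later case
distinctions are strict. -/
lemma ae_regular_point {lam : ℝ} (hlam : 0 < lam) :
    ∀ᵐ x : ℝ, x ≠ 0 ∧ (√lam * x) ^ 2 ≠ 4 * Real.exp (-lam) * (1 - Real.exp (-lam)) := by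
  have hl := (Real.sqrt_pos.2 hlam).ne'
  have h : ∀ a : ℝ, ∀ᵐ x : ℝ, x ≠ a := fun a => by simp [ae_iff]
  set V := 4 * Real.exp (-lam) * (1 - Real.exp (-lam))
  filter_upwards [h 0, h (√V / √lam), h (-(√V / √lam))] with x h0 h1 h2
  refine ⟨h0, fun e => ?_⟩
  have : √V = |√lam * x| := by rw [← e, Real.sqrt_sq_eq_abs]
  rcases abs_choice (√lam * x) with h3 | h3
  · exact h1 (by rw [this, h3]; field_simp)
  · exact h2 (by rw [this, h3]; field_simp)

lemma pi_mul_nonneg_iff {y : ℝ} : 0 ≤ Real.pi * y ↔ 0 ≤ y :=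
  mul_nonneg_iff_of_pos_left Real.pi_pos

lemma ae_lintegral_eq_argDensity {lam : ℝ} (hlam : 0 < lam) (hE : 1 / 2 ≤ Real.exp (-lam)) :
    ∀ᵐ x, 0 ≤ argDensity lam x ∧
      ∫⁻ t in Set.Ioo (0 : ℝ) 1, ENNReal.ofReal (arcsineKernel lam t x) =
        ENNReal.ofReal (Real.pi * argDensity lam x) := by
  filter_upwards [ae_regular_point hlam] with x hx
  rcases lt_or_gt_of_ne hx.2 with h | h
  · rw [← pi_mul_nonneg_iff, argDensity_inside hlam h]
    exact lintegral_arcsineKernel_inside hlam hx.1 h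
  · rw [argDensity_outside hlam h, lintegral_arcsineKernel_outside hlam hE h]
    simp

lemma ae_lintegral_eq_argDensity_add {lam : ℝ} (hlam : 0 < lam) (hE : Real.exp (-lam) ≤ 1 / 2) :
    ∀ᵐ x, 0 ≤ argDensity lam x + saturatedDensity lam x ∧
      ∫⁻ t in Set.Ioo (0 : ℝ) 1, ENNReal.ofReal (arcsineKernel lam t x) =
        ENNReal.ofReal (Real.pi * (argDensity lam x + saturatedDensity lam x)) := by
  filter_upwards [ae_regular_point hlam] with x hx
  rcases lt_or_gt_of_ne hx.2 with h | h
  · have hx1 : (√lam * x) ^ 2 < 1 := by nlinarith [sq_nonneg (2 * Real.exp (-lam) - 1)]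
    have : saturatedDensity lam x = 0 := by
      rw [saturatedDensity, Set.indicator_of_mem ((mem_Ioo_edge_iff hlam x).2 h),
        Set.indicator_of_mem ((mem_Ioo_one_div_sqrt_iff hlam x).2 hx1), sub_self, mul_zero]
    rw [this, add_zero, ← pi_mul_nonneg_iff, argDensity_inside hlam h]
    exact lintegral_arcsineKernel_inside hlam hx.1 h
  · have hn : x ∉ Set.Ioo (-edge lam) (edge lam) := by
      rw [mem_Ioo_edge_iff hlam]; exact h.not_gt
    rw [argDensity_outside hlam h, zero_add, saturatedDensity, Set.indicator_of_notMem hn, sub_zero]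
    by_cases hx1 : (√lam * x) ^ 2 < 1
    · rw [Set.indicator_of_mem ((mem_Ioo_one_div_sqrt_iff hlam x).2 hx1),
        lintegral_arcsineKernel_saturated hlam hx.1 hE hx1 h, mul_one, mul_one_div]
      exact ⟨by positivity, rfl⟩
    · rw [Set.indicator_of_notMem (by rwa [mem_Ioo_one_div_sqrt_iff hlam]),
        lintegral_arcsineKernel_far hlam (not_lt.1 hx1)]
      simp

lemma scaledDensityTendsto_of_ae {lam : ℝ} (hlam : 0 < lam) {r : ℝ → ℝ}
    (hr : ∀ᵐ x, 0 ≤ r x ∧ ∫⁻ t in Set.Ioo (0 : ℝ) 1, ENNReal.ofReal (arcsineKernel lam t x) =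
      ENNReal.ofReal (Real.pi * r x)) : ScaledDensityTendsto lam r := by
  intro f hf
  obtain ⟨hi, he⟩ := integral_arcsineMean hlam hf hr
  refine ⟨fun N hN => jacksonIntegrable_scaledDensity hlam hN hf, hi, ?_⟩
  rw [← he]
  exact tendsto_jacksonIntegral hlam hf

end

end QGUE

theorem proposition4p4 (lam : ℝ) (hlam : 0 < lam) :
    (lam ≤ Real.log 2 → QGUE.ScaledDensityTendsto lam (QGUE.argDensity lam)) ∧
    (Real.log 2 ≤ lam → QGUE.ScaledDensityTendsto lam
      (fun x => QGUE.argDensity lam x + QGUE.saturatedDensity lam x)) := by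
  have e : Real.exp (-Real.log 2) = 1 / 2 := by
    rw [Real.exp_neg, Real.exp_log two_pos, one_div]
  constructor <;> intro h
  · refine QGUE.scaledDensityTendsto_of_ae hlam (QGUE.ae_lintegral_eq_argDensity hlam ?_)
    rw [← e]
    exact Real.exp_le_exp.2 (by linarith)
  · refine QGUE.scaledDensityTendsto_of_ae hlam (QGUE.ae_lintegral_eq_argDensity_add hlam ?_)
    rw [← e]
    exact Real.exp_le_exp.2 (by linarith)
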